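/- Let $M$ be a finite monoid and $\Bbbk$ a field. Write $m\mathrel{\mathscr L}n$ if $Mm=Mn$, $m\mathrel{\mathscr R}n$ if $mM=nM$, $m\mathrel{\mathscr J}n$ if $MmM=MnM$, and let $L_m,R_m,J_m$ be the classes of $m$. Write $m\mathrel{\widetilde{\mathscr R}}n$ if, for every idempotent $f\in M$, $fm=m\iff fn=n$, and let $\widetilde R_m$ be the $\widetilde{\mathscr R}$-class of $m$. The monoid $M$ is left Fountain if every $\widetilde{\mathscr R}$-class contains an idempotent. For an idempotent $e$ let $G_e$ be the group of units of $eMe$ (a maximal subgroup of $M$). A sandwich matrix of $J_e$ is obtained by choosing $\rho_a\in L_e\cap a$ for each $\mathscr R$-class $a\subseteq J_e$ and $\lambda_b\in R_e\cap b$ for each $\mathscr L$-class $b\subseteq J_e$; its entry in row $b$ and column $a$ is $\lambda_b\rho_a$ if $\lambda_b\rho_a\in G_e$, and $0$ otherwise. Let $\Bbbk L_e$ be the $\Bbbk M$-$\Bbbk G_e$-bimodule with basis $L_e$, where $G_e$ acts by right multiplication and $m\in M$ sends $x\in L_e$ to $mx$ if $mx\in L_e$ and to $0$ otherwise. For $X=R_e$,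 and also for $X=\widetilde R_e$ when $M$ is left Fountain, $\Bbbk X$ is dually a $\Bbbk G_e$-$\Bbbk M$-bimodule. For a $\Bbbk G_e$-module $V$ put $\mathrm{Ind}_{G_e}(V)=\Bbbk L_e\otimes_{\Bbbk G_e}V$, and let $\mathrm{Hom}_{G_e}(X,V)$ be the $\Bbbk M$-module of $G_e$-equivariant maps $f\colon X\to V$, with $(mf)(x)=f(xm)$ if $xm\in X$ and $(mf)(x)=0$ otherwise. Put $\mathrm{Coind}_{G_e}(V)=\mathrm{Hom}_{G_e}(R_e,V)$, and for $V$ simple let $V^\sharp$ be the socle of $\mathrm{Coind}_{G_e}(V)$, the simple $\Bbbk M$-module associated to $V$. Let $D=\mathrm{Hom}_{\Bbbk}(-,\Bbbk)$ be the vector space duality between left and right modules. Theorem. Let $M$ be a finite left Fountain monoid and $\Bbbk$ a field whose characteristic does not divide the order of any maximal subgroup of $M$. Let $e_1,\ldots,e_n$ be a complete set of idempotent representatives of the regular $\mathscr J$-classes of $M$ (those containing an idempotent). Then the following are equivalent. 1. Each sandwich matrix of $J_{e_i}$ is left invertible over $\Bbbk G_{e_i}$, for $i=1,\ldots,n$.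 2. Each induced module $\mathrm{Ind}_{G_{e_i}}(V)$ with $V$ a simple $\Bbbk G_{e_i}$-module is simple, for $i=1,\ldots,n$. 3. For $i=1,\ldots,n$ and each simple $\Bbbk G_{e_i}$-module $V$, the injective envelope of the simple $\Bbbk M$-module $V^\sharp$ is $\mathrm{Hom}_{G_{e_i}}(\widetilde R_{e_i},V)$. Moreover, for $i=1,\ldots,n$ and each simple $\Bbbk G_{e_i}$-module $V$, there is an isomorphism of $\Bbbk M$-modules $D(D(V)\otimes_{\Bbbk G_{e_i}}\Bbbk\widetilde R_{e_i})\cong \mathrm{Hom}_{G_{e_i}}(\widetilde R_{e_i},V)$. -/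

import Mathlib

open scoped TensorProduct

universe u v w

noncomputable section

namespace FountainMonoid

/-! ### Green's relations, the relation `R̃`, left Fountain monoids -/

section Monoids

variable {M : Type v} [Monoid M]

/-- `m 𝓛 n` iff `Mm = Mn`. -/
def LRel (m n : M) : Prop := Set.range (fun x : M => x * m) = Set.range (fun x : M => x * n)

/-- `m 𝓡 n` iff `mM = nM`. -/
def RRel (m n : M) : Prop := Set.range (fun x : M => m * x) = Set.range (fun x : M => n * x)

/-- `m 𝓙 n` iff `MmM = MnM`. -/
def JRel (m n : M) : Prop :=
  Set.range (fun p : M × M => p.1 * m * p.2) = Set.range (fun p : M × M => p.1 * n * p.2)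

/-- The `𝓛`-class `L_m`. -/
def LClass (m : M) : Set M := {x | LRel x m}

/-- The `𝓡`-class `R_m`. -/
def RClass (m : M) : Set M := {x | RRel x m}

/-- The `𝓙`-class `J_m`. -/
def JClass (m : M) : Set M := {x | JRel x m}

/-- `m R̃ n` iff for every idempotent `f`: `fm = m` if and only if `fn = n`. -/
def RTildeRel (m n : M) : Prop := ∀ f : M, IsIdempotentElem f → (f * m = m ↔ f * n = n)

/-- The `R̃`-class of `m`. -/
def RTildeClass (m : M) : Set M := {x | RTildeRel x m}

variable (M) in
/-- A monoid is left Fountain if each `R̃`-class contains an idempotent. -/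
class IsLeftFountain : Prop where
  exists_idempotent : ∀ m : M, ∃ e ∈ RTildeClass m, IsIdempotentElem e

variable (M) in
/-- The set `E(M)` of idempotents, as a type. -/
abbrev Idem : Type v := {e : M // IsIdempotentElem e}

/-- The local monoid `eMe`. -/
def LocalMonoid (e : Idem M) : Type v := Subsemigroup.corner (e : M)

/-- `eMe` is a monoid, with the product of `M` and with identity `e`. -/
instance (e : Idem M) : Monoid (LocalMonoid e) where
  mul a b := ⟨a.1 * b.1, (Subsemigroup.corner (e : M)).mul_mem a.2 b.2⟩
  mul_assoc a b c := Subtype.ext (mul_assoc a.1 b.1 c.1)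
  one := ⟨(e : M), (Subsemigroup.mem_corner_iff e.2).2 ⟨e.2, e.2⟩⟩
  one_mul a := Subtype.ext ((Subsemigroup.mem_corner_iff e.2).1 a.2).1
  mul_one a := Subtype.ext ((Subsemigroup.mem_corner_iff e.2).1 a.2).2

/-- The maximal subgroup `G_e`, the group of units of `eMe`. -/
abbrev MaxSubgroup (e : Idem M) : Type v := (LocalMonoid e)ˣ

/-- The inclusion `G_e → M`. -/
def MaxSubgroup.val {e : Idem M} (g : MaxSubgroup e) : M := (g : LocalMonoid e).1

namespace MaxSubgroup

variable {e : Idem M}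

lemma val_mul (g h : MaxSubgroup e) : (g * h).val = g.val * h.val := rfl

lemma val_one : (1 : MaxSubgroup e).val = e := rfl

lemma mul_inv_val (g : MaxSubgroup e) : g.val * (g⁻¹).val = e := by
  rw [← val_mul, mul_inv_cancel, val_one]

lemma inv_mul_val (g : MaxSubgroup e) : (g⁻¹).val * g.val = e := by
  rw [← val_mul, inv_mul_cancel, val_one]

lemma e_mul (g : MaxSubgroup e) : (e : M) * g.val = g.val := by
  rw [← val_one, ← val_mul, one_mul]

lemma mul_e (g : MaxSubgroup e) : g.val * (e : M) = g.val := by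
  rw [← val_one, ← val_mul, mul_one]

end MaxSubgroup

lemma lRel_iff {m n : M} : LRel m n ↔ (∃ x, x * n = m) ∧ (∃ x, x * m = n) := by
  constructor
  · intro h
    have h1 : m ∈ Set.range (fun x : M => x * n) := h ▸ ⟨1, one_mul m⟩
    have h2 : n ∈ Set.range (fun x : M => x * m) := h.symm ▸ ⟨1, one_mul n⟩
    exact ⟨h1, h2⟩
  · rintro ⟨⟨x, rfl⟩, ⟨y, hy⟩⟩
    apply Set.Subset.antisymm
    · rintro _ ⟨z, rfl⟩
      exact ⟨z * x, mul_assoc _ _ _⟩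
    · rintro _ ⟨z, rfl⟩
      exact ⟨z * y, by simp only [mul_assoc, hy]⟩

lemma rRel_iff {m n : M} : RRel m n ↔ (∃ x, n * x = m) ∧ (∃ x, m * x = n) := by
  constructor
  · intro h
    have h1 : m ∈ Set.range (fun x : M => n * x) := h ▸ ⟨1, mul_one m⟩
    have h2 : n ∈ Set.range (fun x : M => m * x) := h.symm ▸ ⟨1, mul_one n⟩
    exact ⟨h1, h2⟩
  · rintro ⟨⟨x, rfl⟩, ⟨y, hy⟩⟩
    apply Set.Subset.antisymm
    · rintro _ ⟨z, rfl⟩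
      exact ⟨x * z, (mul_assoc _ _ _).symm⟩
    · rintro _ ⟨z, rfl⟩
      exact ⟨y * z, by simp only [← mul_assoc, hy]⟩

/-! `M` acts on the left of `L_e` by partial maps, `G_e` acts on the right by total maps. -/

lemma LClass.mul_e {e : Idem M} {x : M} (hx : x ∈ LClass (e : M)) : x * e = x := by
  obtain ⟨⟨y, rfl⟩, -⟩ := lRel_iff.1 hx
  rw [mul_assoc, e.2]

lemma LClass.of_mul {e : Idem M} {x m n : M} (hx : x ∈ LClass (e : M))
    (h : m * (n * x) ∈ LClass (e : M)) : n * x ∈ LClass (e : M) := by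
  obtain ⟨⟨y, hy⟩, -⟩ := lRel_iff.1 hx
  obtain ⟨-, ⟨z, hz⟩⟩ := lRel_iff.1 h
  exact lRel_iff.2 ⟨⟨n * y, by rw [mul_assoc, hy]⟩, ⟨z * m, by rw [mul_assoc, hz]⟩⟩

lemma LClass.mul_G {e : Idem M} {x : M} (hx : x ∈ LClass (e : M)) (g : MaxSubgroup e) :
    x * g.val ∈ LClass (e : M) := by
  obtain ⟨⟨y, hy⟩, ⟨z, hz⟩⟩ := lRel_iff.1 hx
  refine lRel_iff.2 ⟨⟨x * g.val, by rw [mul_assoc, g.mul_e]⟩, ⟨(g⁻¹).val * z, ?_⟩⟩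
  rw [mul_assoc, ← mul_assoc z, hz, g.e_mul, g.inv_mul_val]

/-- A subset `X` of `eM` on which `G_e` acts by left multiplication and on which `M` acts by partial
maps by right multiplication (`x · m` being defined when `xm ∈ X`). -/
structure IsBiset (e : Idem M) (X : Set M) : Prop where
  e_mul : ∀ {x}, x ∈ X → (e : M) * x = x
  G_mul : ∀ (g : MaxSubgroup e) {x}, x ∈ X → g.val * x ∈ X
  of_mul : ∀ {x m n}, x ∈ X → x * m * n ∈ X → x * m ∈ X

lemma IsBiset.G_mul_mem_iff {e : Idem M} {X : Set M} (hX : IsBiset e X) (g : MaxSubgroup e)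
    {x m : M} (hx : x ∈ X) : g.val * x * m ∈ X ↔ x * m ∈ X := by
  constructor
  · intro h
    have := hX.G_mul g⁻¹ h
    rwa [← mul_assoc, ← mul_assoc, g.inv_mul_val, hX.e_mul hx] at this
  · intro h
    rw [mul_assoc]
    exact hX.G_mul g h

lemma isBiset_RClass (e : Idem M) : IsBiset e (RClass (e : M)) where
  e_mul {x} hx := by
    obtain ⟨⟨y, rfl⟩, -⟩ := rRel_iff.1 hx
    rw [← mul_assoc, e.2]
  G_mul g {x} hx := by
    obtain ⟨⟨y, hy⟩, ⟨z, hz⟩⟩ := rRel_iff.1 hx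
    refine rRel_iff.2 ⟨⟨g.val * x, by rw [← mul_assoc, g.e_mul]⟩, ⟨z * (g⁻¹).val, ?_⟩⟩
    rw [← mul_assoc, mul_assoc g.val, hz, g.mul_e, g.mul_inv_val]
  of_mul {x m n} hx h := by
    obtain ⟨⟨y, hy⟩, -⟩ := rRel_iff.1 hx
    obtain ⟨-, ⟨z, hz⟩⟩ := rRel_iff.1 h
    exact rRel_iff.2 ⟨⟨y * m, by rw [← mul_assoc, hy]⟩, ⟨n * z, by rw [← mul_assoc, hz]⟩⟩

lemma exists_idempotent_pow [Finite M] (t : M) : ∃ n : ℕ, IsIdempotentElem (t ^ (n + 1)) := by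
  obtain ⟨a, b, hne, h⟩ := Finite.exists_ne_map_eq_of_infinite (fun n : ℕ => t ^ n)
  wlog hab : a < b generalizing a b
  · exact this b a hne.symm h.symm (by omega)
  obtain ⟨d, rfl⟩ := Nat.exists_eq_add_of_lt hab
  have h : t ^ a = t ^ (a + d + 1) := h
  have key : ∀ j i : ℕ, t ^ (a + i) = t ^ (a + i + j * (d + 1)) := by
    intro j
    induction j with
    | zero => intro i; simp
    | succ j ih =>
      intro i
      have h1 : a + i + (j + 1) * (d + 1) = (a + d + 1) + (i + j * (d + 1)) := by ring
      have h2 : a + i + j * (d + 1) = a + (i + j * (d + 1)) := by ring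
      rw [ih i, h1, h2, pow_add t a, pow_add t (a + d + 1), h]
  refine ⟨(a + 1) * (d + 1) - 1, ?_⟩
  have hn : (a + 1) * (d + 1) - 1 + 1 = a + (a * d + d + 1) := by
    have : (a + 1) * (d + 1) = a + (a * d + d + 1) := by ring
    omega
  have h3 : a + (a * d + d + 1) + (a + (a * d + d + 1)) =
      a + (a * d + d + 1) + (a + 1) * (d + 1) := by ring
  rw [hn]
  show t ^ _ * t ^ _ = t ^ _
  rw [← pow_add, h3, ← key]

lemma isBiset_RTildeClass [Finite M] [IsLeftFountain M] (e : Idem M) :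
    IsBiset e (RTildeClass (e : M)) where
  e_mul {x} hx := (hx e e.2).2 e.2
  G_mul g {x} hx := by
    obtain ⟨a, ha, haa⟩ := IsLeftFountain.exists_idempotent (g.val * x)
    have hex : (e : M) * x = x := (hx e e.2).2 e.2
    have hagx : a * (g.val * x) = g.val * x := (ha a haa).1 haa
    have hea : (e : M) * a = a := (ha e e.2).2 (by rw [← mul_assoc, g.e_mul])
    obtain ⟨n, hn⟩ := exists_idempotent_pow ((g⁻¹).val * a * g.val)
    have htx : (g⁻¹).val * a * g.val * x = x := by
      rw [mul_assoc, mul_assoc, hagx, ← mul_assoc, g.inv_mul_val, hex]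
    have htnx : ∀ i : ℕ, ((g⁻¹).val * a * g.val) ^ i * x = x := by
      intro i
      induction i with
      | zero => simp
      | succ i ih => rw [pow_succ, mul_assoc, htx, ih]
    have hte := (hx _ hn).1 (htnx _)
    have hae : a * (e : M) = e := by
      rw [pow_succ'] at hte
      simp only [mul_assoc] at hte
      generalize g.val * ((((g⁻¹).val * (a * g.val)) ^ n) * (e : M)) = y at hte
      have hg : g.val = a * y := by
        calc g.val = g.val * e := g.mul_e.symm
          _ = g.val * ((g⁻¹).val * (a * y)) := by rw [hte]
          _ = a * y := by rw [← mul_assoc, g.mul_inv_val, ← mul_assoc, hea]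
      have hag : a * g.val = g.val := by rw [hg, ← mul_assoc, haa]
      rw [← g.mul_inv_val, ← mul_assoc, hag]
    intro f hf
    rw [← ha f hf]
    constructor
    · intro h
      rw [← hae, ← mul_assoc, h]
    · intro h
      rw [← hea, ← mul_assoc, h]
  of_mul {x m n} hx h := by
    intro f hf
    constructor
    · intro h1
      exact (h f hf).1 (by rw [← mul_assoc, h1])
    · intro h1
      rw [← mul_assoc, (hx f hf).2 h1]

/-! ### Sandwich matrices -/

/-- The set of `𝓡`-classes of `M` contained in `J_e`. -/
def RClasses (e : M) : Set (Set M) := RClass '' JClass e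

/-- The set of `𝓛`-classes of `M` contained in `J_e`. -/
def LClasses (e : M) : Set (Set M) := LClass '' JClass e

/-- Representatives `ρ_a ∈ L_e ∩ a` of the `𝓡`-classes `a` of `J_e`, and `λ_b ∈ R_e ∩ b` of the
`𝓛`-classes `b` of `J_e`. -/
structure SandwichReps (e : Idem M) where
  rho : RClasses (e : M) → M
  rho_mem : ∀ a, rho a ∈ LClass (e : M) ∩ a.1
  lam : LClasses (e : M) → M
  lam_mem : ∀ b, lam b ∈ RClass (e : M) ∩ b.1

open Classical in
/-- The sandwich matrix of `J_e` for the given representatives, as a matrix over `kG_e`: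
`P(b,a) = λ_b ρ_a` if this element belongs to `G_e`, and `P(b,a) = 0` otherwise. -/
def sandwichMatrix (k : Type u) [Field k] {e : Idem M} (s : SandwichReps e) :
    Matrix (LClasses (e : M)) (RClasses (e : M)) (MonoidAlgebra k (MaxSubgroup e)) :=
  fun b a =>
    if h : ∃ g : MaxSubgroup e, g.val = s.lam b * s.rho a then MonoidAlgebra.single h.choose 1
    else 0

end Monoids

open Classical in
/-- A matrix `P` over a ring is left invertible if `QP` is an identity matrix for some `Q`. -/
def IsLeftInvertible {A B : Type*} {S : Type*} [Ring S] [Finite B] (P : Matrix B A S) : Prop :=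
  letI := Fintype.ofFinite B
  ∃ Q : Matrix A B S, Q * P = 1

/-! ### Injective envelopes -/

section Modules

variable (S : Type*) [Ring S]

/-- `I` is an injective envelope of `W`: it is injective and it is an essential extension of an
isomorphic copy of `W`. -/
def IsInjectiveEnvelope (W : Type*) [AddCommGroup W] [Module S W]
    (I : Type*) [AddCommGroup I] [Module S I] : Prop :=
  Module.Injective S I ∧
    ∃ j : W →ₗ[S] I, Function.Injective j ∧
      ∀ N : Submodule S I, N ⊓ LinearMap.range j = ⊥ → N = ⊥

end Modules

/-! ### Socles, duals and tensor products of representations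

Left modules over a monoid algebra `kN` are given as representations of `N`, and right modules as
representations of `Nᵐᵒᵖ`. -/

section Representations

variable {k : Type u} [Field k]

/-- The socle of a representation, i.e. the sum of all its irreducible subrepresentations. -/
def socle {N : Type*} [Monoid N] {X : Type*} [AddCommGroup X] [Module k X]
    (σ : Representation k N X) : Subrepresentation σ where
  toSubmodule := ⨆ (S : Subrepresentation σ) (_ : S.toRepresentation.IsIrreducible), S.toSubmodule
  apply_mem_toSubmodule n := by
    refine show (⨆ (S : Subrepresentation σ) (_ : S.toRepresentation.IsIrreducible), S.toSubmodule) ≤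
      Submodule.comap (σ n) (⨆ (S : Subrepresentation σ)
        (_ : S.toRepresentation.IsIrreducible), S.toSubmodule) from ?_
    refine iSup₂_le fun S hS x hx => ?_
    exact (le_iSup₂_of_le (f := fun (S : Subrepresentation σ)
      (_ : S.toRepresentation.IsIrreducible) => S.toSubmodule) S hS le_rfl)
      (S.apply_mem_toSubmodule n hx)

/-- The left module `D(X)` for a right module `X`, with `(nF)(x) = F(xn)`. -/
def leftDual {N : Type*} [Monoid N] {X : Type*} [AddCommGroup X] [Module k X]
    (τ : Representation k Nᵐᵒᵖ X) : Representation k N (Module.Dual k X) where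
  toFun n := (τ (MulOpposite.op n)).dualMap
  map_one' := by ext; simp
  map_mul' a b := by ext; simp

/-- The right module `D(Y)` for a left module `Y`, with `(Fn)(y) = F(ny)`. -/
def rightDual {N : Type*} [Monoid N] {Y : Type*} [AddCommGroup Y] [Module k Y]
    (ρ : Representation k N Y) : Representation k Nᵐᵒᵖ (Module.Dual k Y) where
  toFun n := (ρ n.unop).dualMap
  map_one' := by ext; simp
  map_mul' a b := by ext; simp

variable {G : Type*} [Monoid G] {X Y : Type*} [AddCommGroup X] [Module k X] [AddCommGroup Y]
  [Module k Y]

/-- The subspace of `X ⊗ₖ Y` by which one divides to form `X ⊗_{kG} Y`, spanned by the elements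
`xg ⊗ y - x ⊗ gy`. -/
def balanced (τ : Representation k Gᵐᵒᵖ X) (ρ : Representation k G Y) : Submodule k (X ⊗[k] Y) :=
  Submodule.span k {t | ∃ (x : X) (g : G) (y : Y), t = τ (MulOpposite.op g) x ⊗ₜ[k] y - x ⊗ₜ[k] ρ g y}

/-- The tensor product `X ⊗_{kG} Y` of a right module `X` and a left module `Y`. -/
abbrev BalancedTensor (τ : Representation k Gᵐᵒᵖ X) (ρ : Representation k G Y) : Type _ :=
  (X ⊗[k] Y) ⧸ balanced τ ρ

/-- The action `n(x ⊗ y) = nx ⊗ y` on `X ⊗_{kG} Y` when `X` is a bimodule. -/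
def tensorActLeft {N : Type*} [Monoid N] (τ : Representation k Gᵐᵒᵖ X) (ρ : Representation k G Y)
    (σ : Representation k N X) (h : ∀ n g x, σ n (τ g x) = τ g (σ n x)) :
    Representation k N (BalancedTensor τ ρ) :=
  (σ.tprod (Representation.trivial k N Y)).quotient (balanced τ ρ) <| by
    intro n
    refine Submodule.span_le.2 ?_
    rintro _ ⟨x, g, y, rfl⟩
    refine Submodule.subset_span ⟨σ n x, g, y, ?_⟩
    simp [h]

/-- The action on `X ⊗_{kG} Y` induced by an action on `Y` commuting with that of `G`. For a bimodule
`Y` we take `N = Kᵐᵒᵖ`, and this is the right action `(x ⊗ y)m = x ⊗ ym`. -/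
def tensorActRight {N : Type*} [Monoid N] (τ : Representation k Gᵐᵒᵖ X) (ρ : Representation k G Y)
    (σ : Representation k N Y) (h : ∀ n g y, σ n (ρ g y) = ρ g (σ n y)) :
    Representation k N (BalancedTensor τ ρ) :=
  ((Representation.trivial k N X).tprod σ).quotient (balanced τ ρ) <| by
    intro n
    refine Submodule.span_le.2 ?_
    rintro _ ⟨x, g, y, rfl⟩
    refine Submodule.subset_span ⟨x, g, σ n y, ?_⟩
    simp [h]

end Representations

/-! ### The modules `kX` for partial actions -/

section PartialAction

variable {M : Type v} (k : Type u) [Field k]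

open Classical in
/-- The linear endomorphism of `kX` sending a basis element `x ∈ X` to `f x` if `f x ∈ X`, and to `0`
otherwise. -/
def partialMap (X : Set M) (f : M → M) : (X →₀ k) →ₗ[k] (X →₀ k) :=
  Finsupp.linearCombination k fun x : X => if h : f x ∈ X then Finsupp.single ⟨f x, h⟩ 1 else 0

variable {k} in
lemma partialMap_single {X : Set M} {f : M → M} {x : X} (h : f x ∈ X) (c : k) :
    partialMap k X f (Finsupp.single x c) = Finsupp.single ⟨f x, h⟩ c := by
  simp [partialMap, h]

variable {k} in
lemma partialMap_single_of_notMem {X : Set M} {f : M → M} {x : X} (h : f x ∉ X) (c : k) :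
    partialMap k X f (Finsupp.single x c) = 0 := by
  simp [partialMap, h]

lemma partialMap_eq_one {X : Set M} {f : M → M} (h : ∀ x ∈ X, f x = x) :
    partialMap k X f = 1 := by
  refine Finsupp.lhom_ext fun x c => ?_
  have hx : f x ∈ X := by rw [h x x.2]; exact x.2
  rw [partialMap_single hx]
  congr 1
  exact Subtype.ext (h x x.2)

lemma partialMap_comp {X : Set M} {f g l : M → M} (hl : ∀ x ∈ X, l x = f (g x))
    (h : ∀ x ∈ X, f (g x) ∈ X → g x ∈ X) :
    partialMap k X l = partialMap k X f * partialMap k X g := by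
  refine Finsupp.lhom_ext fun x c => ?_
  rw [Module.End.mul_apply]
  by_cases hg : g x ∈ X
  · rw [partialMap_single hg]
    by_cases hf : f (g x) ∈ X
    · have hlx : l x ∈ X := by rw [hl x x.2]; exact hf
      rw [partialMap_single (x := ⟨g x, hg⟩) hf, partialMap_single hlx]
      congr 1
      exact Subtype.ext (hl x x.2)
    · have hlx : l x ∉ X := by rw [hl x x.2]; exact hf
      rw [partialMap_single_of_notMem (x := ⟨g x, hg⟩) hf, partialMap_single_of_notMem hlx]
  · have hlx : l x ∉ X := by rw [hl x x.2]; exact fun h' => hg (h x x.2 h')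
    rw [partialMap_single_of_notMem hg, partialMap_single_of_notMem hlx, map_zero]

variable [Monoid M]

/-- The left `kM`-module `kL_e`: for `x ∈ L_e`, `m • x = mx` if `mx ∈ L_e`, and `m • x = 0`
otherwise. -/
def LRep (e : Idem M) : Representation k M (LClass (e : M) →₀ k) where
  toFun m := partialMap k (LClass (e : M)) (fun x => m * x)
  map_one' := partialMap_eq_one k fun x _ => one_mul x
  map_mul' m n := partialMap_comp k (fun x _ => mul_assoc m n x) fun _ hx h => LClass.of_mul hx h

/-- The right `kG_e`-module structure of `kL_e`, by right multiplication. -/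
def LRepG (e : Idem M) : Representation k (MaxSubgroup e)ᵐᵒᵖ (LClass (e : M) →₀ k) where
  toFun g := partialMap k (LClass (e : M)) (fun x => x * g.unop.val)
  map_one' := partialMap_eq_one k fun _ hx => LClass.mul_e hx
  map_mul' g h := partialMap_comp k
    (fun x _ => by rw [MulOpposite.unop_mul, MaxSubgroup.val_mul, mul_assoc])
    fun _ hx _ => LClass.mul_G hx _

lemma LRep_comm (e : Idem M) (m : M) (g : (MaxSubgroup e)ᵐᵒᵖ) (x : LClass (e : M) →₀ k) :
    LRep k e m (LRepG k e g x) = LRepG k e g (LRep k e m x) := by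
  have h1 := partialMap_comp k (X := LClass (e : M)) (f := fun x => m * x)
    (g := fun x => x * g.unop.val) (l := fun x => m * (x * g.unop.val)) (fun _ _ => rfl)
    (fun _ hx _ => LClass.mul_G hx _)
  have h2 := partialMap_comp k (X := LClass (e : M)) (f := fun x => x * g.unop.val)
    (g := fun x => m * x) (l := fun x => m * (x * g.unop.val))
    (fun _ _ => (mul_assoc _ _ _).symm) (fun x hx h => by
      have := LClass.mul_G h g.unop⁻¹
      rwa [mul_assoc, g.unop.mul_inv_val, mul_assoc, LClass.mul_e hx] at this)
  exact LinearMap.congr_fun (h1.symm.trans h2) x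

/-- The left `kG_e`-module structure of `kX`, by left multiplication. -/
def bisetRepG {e : Idem M} {X : Set M} (hX : IsBiset e X) :
    Representation k (MaxSubgroup e) (X →₀ k) where
  toFun g := partialMap k X (fun x => g.val * x)
  map_one' := partialMap_eq_one k fun _ hx => hX.e_mul hx
  map_mul' g h := partialMap_comp k (fun x _ => by rw [MaxSubgroup.val_mul, mul_assoc])
    fun _ hx _ => hX.G_mul _ hx

/-- The right `kM`-module `kX`: for `x ∈ X`, `x • m = xm` if `xm ∈ X`, and `x • m = 0`
otherwise. -/
def bisetRep {e : Idem M} {X : Set M} (hX : IsBiset e X) : Representation k Mᵐᵒᵖ (X →₀ k) where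
  toFun m := partialMap k X (fun x => x * m.unop)
  map_one' := partialMap_eq_one k fun x _ => mul_one x
  map_mul' m n := partialMap_comp k
    (fun x _ => by rw [MulOpposite.unop_mul, mul_assoc]) fun _ hx h => hX.of_mul hx h

lemma bisetRep_comm {e : Idem M} {X : Set M} (hX : IsBiset e X) (m : Mᵐᵒᵖ) (g : MaxSubgroup e)
    (x : X →₀ k) : bisetRep k hX m (bisetRepG k hX g x) = bisetRepG k hX g (bisetRep k hX m x) := by
  have h1 := partialMap_comp k (X := X) (f := fun x => x * m.unop)
    (g := fun x => g.val * x) (l := fun x => g.val * x * m.unop) (fun _ _ => rfl)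
    (fun _ hx _ => hX.G_mul _ hx)
  have h2 := partialMap_comp k (X := X) (f := fun x => g.val * x)
    (g := fun x => x * m.unop) (l := fun x => g.val * x * m.unop)
    (fun _ _ => mul_assoc _ _ _) (fun x hx h => by
      rwa [← mul_assoc, hX.G_mul_mem_iff g hx] at h)
  exact LinearMap.congr_fun (h1.symm.trans h2) x

end PartialAction

/-! ### Induced and coinduced modules, and the simple modules `V♯` -/

section IndCoind

variable {k : Type u} [Field k] {M : Type v} [Monoid M] {e : Idem M}
  {V : Type w} [AddCommGroup V] [Module k V]

/-- The induced module `Ind_{G_e}(V) = kL_e ⊗_{kG_e} V`. -/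
def Ind (ρ : Representation k (MaxSubgroup e) V) :
    Representation k M (BalancedTensor (LRepG k e) ρ) :=
  tensorActLeft (LRepG k e) ρ (LRep k e) (LRep_comm k e)

/-- The subspace of `G_e`-equivariant maps in the space of all maps `X → V`. -/
def EquivariantMaps {X : Set M} (hX : IsBiset e X) (ρ : Representation k (MaxSubgroup e) V) :
    Submodule k (X → V) where
  carrier := {f | ∀ (g : MaxSubgroup e) (x : X), f ⟨g.val * x, hX.G_mul g x.2⟩ = ρ g (f x)}
  add_mem' {f f'} hf hf' g x := by
    simp only [Pi.add_apply, map_add]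
    rw [hf g x, hf' g x]
  zero_mem' g x := by simp
  smul_mem' c f hf g x := by
    simp only [Pi.smul_apply, map_smul]
    rw [hf g x]

/-- The space `Hom_{G_e}(X, V)` of `G_e`-equivariant maps `X → V`. -/
def HomG {X : Set M} (hX : IsBiset e X) (ρ : Representation k (MaxSubgroup e) V) : Type (max v w) :=
  EquivariantMaps hX ρ

instance {X : Set M} (hX : IsBiset e X) (ρ : Representation k (MaxSubgroup e) V) :
    AddCommGroup (HomG hX ρ) :=
  inferInstanceAs (AddCommGroup (EquivariantMaps hX ρ))

instance {X : Set M} (hX : IsBiset e X) (ρ : Representation k (MaxSubgroup e) V) :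
    Module k (HomG hX ρ) :=
  inferInstanceAs (Module k (EquivariantMaps hX ρ))

open Classical in
/-- The action of `m ∈ M` on `Hom_{G_e}(X, V)`: `(mf)(x) = f(xm)` if `xm ∈ X`, and `(mf)(x) = 0`
otherwise. -/
def homAct {X : Set M} {hX : IsBiset e X} {ρ : Representation k (MaxSubgroup e) V} (m : M)
    (f : HomG hX ρ) : HomG hX ρ :=
  ⟨fun x => if h : (x : M) * m ∈ X then f.1 ⟨x * m, h⟩ else 0, by
    intro g x
    by_cases h : (x : M) * m ∈ X
    · have h' := (hX.G_mul_mem_iff g x.2).2 h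
      simp only [dif_pos h, dif_pos h']
      rw [← f.2 g ⟨x * m, h⟩]
      exact congrArg f.1 (Subtype.ext (mul_assoc _ _ _))
    · have h' := mt (hX.G_mul_mem_iff g x.2).1 h
      simp only [dif_neg h, dif_neg h', map_zero]⟩

lemma homAct_of_mem {X : Set M} {hX : IsBiset e X} {ρ : Representation k (MaxSubgroup e) V} {m : M}
    (f : HomG hX ρ) {x : X} (h : (x : M) * m ∈ X) : (homAct m f).1 x = f.1 ⟨x * m, h⟩ :=
  dif_pos h

lemma homAct_of_notMem {X : Set M} {hX : IsBiset e X} {ρ : Representation k (MaxSubgroup e) V}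
    {m : M} (f : HomG hX ρ) {x : X} (h : (x : M) * m ∉ X) : (homAct m f).1 x = 0 :=
  dif_neg h

lemma HomG.add_val {X : Set M} {hX : IsBiset e X} {ρ : Representation k (MaxSubgroup e) V}
    (f f' : HomG hX ρ) (x : X) : (f + f').1 x = f.1 x + f'.1 x := rfl

lemma HomG.smul_val {X : Set M} {hX : IsBiset e X} {ρ : Representation k (MaxSubgroup e) V}
    (c : k) (f : HomG hX ρ) (x : X) : (c • f).1 x = c • f.1 x := rfl

/-- The `kM`-module `Hom_{G_e}(X, V)`. -/
def homRep {X : Set M} (hX : IsBiset e X) (ρ : Representation k (MaxSubgroup e) V) :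
    Representation k M (HomG hX ρ) where
  toFun m :=
    { toFun := homAct m
      map_add' := fun f f' => by
        refine Subtype.ext (funext fun x => ?_)
        rw [HomG.add_val]
        by_cases h : (x : M) * m ∈ X
        · simp only [homAct_of_mem _ h, HomG.add_val]
        · simp only [homAct_of_notMem _ h, add_zero]
      map_smul' := fun c f => by
        refine Subtype.ext (funext fun x => ?_)
        rw [RingHom.id_apply, HomG.smul_val]
        by_cases h : (x : M) * m ∈ X
        · simp only [homAct_of_mem _ h, HomG.smul_val]
        · simp only [homAct_of_notMem _ h, smul_zero] }
  map_one' := by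
    refine LinearMap.ext fun f => Subtype.ext (funext fun x => ?_)
    have h : (x : M) * 1 ∈ X := by rw [mul_one]; exact x.2
    exact (homAct_of_mem f h).trans (congrArg f.1 (Subtype.ext (mul_one _)))
  map_mul' m n := by
    refine LinearMap.ext fun f => Subtype.ext (funext fun x => ?_)
    change (homAct (m * n) f).1 x = (homAct m (homAct n f)).1 x
    by_cases h : (x : M) * m ∈ X
    · rw [homAct_of_mem _ h]
      by_cases h' : (x : M) * m * n ∈ X
      · rw [homAct_of_mem f (x := ⟨x * m, h⟩) h', homAct_of_mem f (by rwa [← mul_assoc])]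
        exact congrArg f.1 (Subtype.ext (mul_assoc _ _ _).symm)
      · rw [homAct_of_notMem f (x := ⟨x * m, h⟩) h', homAct_of_notMem f (by rwa [← mul_assoc])]
    · have h' : (x : M) * (m * n) ∉ X := fun h' =>
        h (hX.of_mul (n := n) x.2 (by rwa [mul_assoc]))
      rw [homAct_of_notMem _ h, homAct_of_notMem _ h']

/-- The coinduced module `Coind_{G_e}(V) = Hom_{G_e}(R_e, V)`. -/
abbrev Coind (ρ : Representation k (MaxSubgroup e) V) :
    Representation k M (HomG (isBiset_RClass e) ρ) :=
  homRep (isBiset_RClass e) ρ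

/-- The `kM`-module `V♯`, defined as the socle of `Coind_{G_e}(V)`. -/
abbrev Sharp (ρ : Representation k (MaxSubgroup e) V) :
    Representation k M (socle (Coind ρ)).toSubmodule :=
  (socle (Coind ρ)).toRepresentation

/-- The `kM`-module `Hom_{G_e}(R̃_e, V)`. -/
abbrev HomRTilde [Finite M] [IsLeftFountain M] (ρ : Representation k (MaxSubgroup e) V) :
    Representation k M (HomG (isBiset_RTildeClass e) ρ) :=
  homRep (isBiset_RTildeClass e) ρ

/-- The right `kM`-module `D(V) ⊗_{kG_e} kR̃_e`. -/
def dualTensorRTilde [Finite M] [IsLeftFountain M] (ρ : Representation k (MaxSubgroup e) V) :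
    Representation k Mᵐᵒᵖ
      (BalancedTensor (rightDual ρ) (bisetRepG k (isBiset_RTildeClass e))) :=
  tensorActRight (rightDual ρ) (bisetRepG k (isBiset_RTildeClass e))
    (bisetRep k (isBiset_RTildeClass e)) (bisetRep_comm k (isBiset_RTildeClass e))

end IndCoind

end FountainMonoid

end

open FountainMonoid

noncomputable section

namespace FountainMonoid

/-! ### Stability and Green's relations in finite monoids -/

section Green

variable {M : Type v} [Monoid M]

/-! The proof runs 1 → 3 → 2 → 1. For a module `Y` and an idempotent `e`, the key object is `below k
Y e`, the part of `eY` spanned by the `mY` with `m ∈ eM \ R̃_e`. By `homOfLinear` and `evalIdem`, a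
`kM`-map `Y → Hom_G(R̃_e, V)` amounts to a `G_e`-map `eY → V` vanishing on `below k Y e`. Such maps
extend from a submodule `N` to `Y`, by linear algebra and averaging over `G_e`, as soon as `below Y
∩ N = below N`.

1 → 3. The intersection property comes from counting dimensions over representatives `e_q` of the
`R̃`-classes. Always `dim Y + Σ dim below ≤ Σ dim e_qY` (`finrank_add_sum_below_le`). For a simple
`S` with apex `e_j`, left invertibility embeds one copy of `e_jS` per `𝓡`-class of the `𝓙`-class
into `S`, which gives the reverse inequality (`simpleBound_of_isLeftInvertible`). This passes
through extensions, and equality everywhere forces `below Y ∩ N = below N` (`SimpleBound.inf_le`).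
The envelope is essential because every simple submodule of `Hom_G(R̃_e, V)` contains a nonzero map
supported on `R_e`, which lies in the socle of the coinduced module (`sharpInclusion_essential`).

3 → 2. A nonzero submodule of `Ind V` not killed by `e` contains a nonzero `e ⊗ v`, hence is
everything. One killed by `e` contains a simple `S` with another apex `e_j`; by injectivity the
nonzero map `S → Hom_G(R̃_{e_j}, e_jS)` would extend to `Ind V`, from which there are no nonzero
maps to that target.

2 → 1. If the rows of the sandwich matrix do not span the free module, a maximal submodule
containing them has a simple quotient `V`, and the images of the basis vectors assemble into a
nonzero element of the kernel of `Ind V → Coind V`, a proper submodule.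

The last isomorphism is tensor-hom adjunction together with `V ≅ D(D(V))`. -/

lemma pow_mul_mul_pow {f c d : M} (h : c * f * d = f) (j : ℕ) : c ^ j * f * d ^ j = f := by
  induction j with
  | zero => simp
  | succ j ih =>
    calc c ^ (j + 1) * f * d ^ (j + 1) = c ^ j * (c * f * d) * d ^ j := by
          rw [pow_succ, pow_succ']; simp only [mul_assoc]
      _ = f := by rw [h, ih]

/-- Since `c^j f d^j = f` for all `j`, an exponent making `c^j` idempotent lets a further factor
`c^j` be absorbed. -/
lemma exists_pow_mul_eq [Finite M] {f c d : M} (h : c * f * d = f) :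
    ∃ n : ℕ, c ^ (n + 1) * f = f := by
  obtain ⟨n, hn⟩ := exists_idempotent_pow c
  refine ⟨n, ?_⟩
  have h1 := pow_mul_mul_pow h (n + 1)
  calc c ^ (n + 1) * f = c ^ (n + 1) * (c ^ (n + 1) * f * d ^ (n + 1)) := by rw [h1]
    _ = (c ^ (n + 1) * c ^ (n + 1)) * f * d ^ (n + 1) := by simp only [mul_assoc]
    _ = f := by rw [hn, h1]

lemma exists_mul_pow_eq [Finite M] {f c d : M} (h : c * f * d = f) :
    ∃ n : ℕ, f * d ^ (n + 1) = f := by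
  obtain ⟨n, hn⟩ := exists_idempotent_pow d
  refine ⟨n, ?_⟩
  have h1 := pow_mul_mul_pow h (n + 1)
  calc f * d ^ (n + 1) = (c ^ (n + 1) * f * d ^ (n + 1)) * d ^ (n + 1) := by rw [h1]
    _ = c ^ (n + 1) * f * (d ^ (n + 1) * d ^ (n + 1)) := by simp only [mul_assoc]
    _ = f := by rw [hn, h1]

lemma jRel_iff {m n : M} : JRel m n ↔ (∃ a b, a * n * b = m) ∧ (∃ a b, a * m * b = n) := by
  constructor
  · intro h
    have h1 : m ∈ Set.range (fun p : M × M => p.1 * n * p.2) := h ▸ ⟨(1, 1), by simp⟩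
    have h2 : n ∈ Set.range (fun p : M × M => p.1 * m * p.2) := h.symm ▸ ⟨(1, 1), by simp⟩
    obtain ⟨p, hp⟩ := h1
    obtain ⟨q, hq⟩ := h2
    exact ⟨⟨p.1, p.2, hp⟩, ⟨q.1, q.2, hq⟩⟩
  · rintro ⟨⟨a, b, rfl⟩, ⟨c, d, hc⟩⟩
    apply Set.Subset.antisymm
    · rintro _ ⟨z, rfl⟩
      exact ⟨(z.1 * a, b * z.2), by simp only [mul_assoc]⟩
    · rintro _ ⟨z, rfl⟩
      exact ⟨(z.1 * c, d * z.2), by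
        calc z.1 * c * (a * n * b) * (d * z.2) = z.1 * (c * (a * n * b) * d) * z.2 := by
              simp only [mul_assoc]
          _ = _ := by rw [hc]⟩

/-- Stability of finite monoids: a power of `cm` fixes `f`, so `f` is already a left multiple of
`mf`. -/
lemma mul_mem_LClass [Finite M] {f m c d : M} (h : c * (m * f) * d = f) :
    m * f ∈ LClass f := by
  obtain ⟨n, hn⟩ := exists_pow_mul_eq (f := f) (c := c * m) (d := d)
    (by rw [mul_assoc c m f, h])
  refine lRel_iff.2 ⟨⟨m, rfl⟩, ⟨(c * m) ^ n * c, ?_⟩⟩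
  rw [pow_succ] at hn
  simpa only [mul_assoc] using hn

lemma mul_mem_RClass [Finite M] {f m c d : M} (h : c * (f * m) * d = f) :
    f * m ∈ RClass f := by
  obtain ⟨n, hn⟩ := exists_mul_pow_eq (f := f) (c := c) (d := m * d)
    (by simpa only [mul_assoc] using h)
  refine rRel_iff.2 ⟨⟨m, rfl⟩, ⟨d * (m * d) ^ n, ?_⟩⟩
  rw [pow_succ'] at hn
  simpa only [mul_assoc] using hn

/-! ### Maximal subgroups and their orbits on `L_e` and `R_e`. -/

instance [Finite M] (e : Idem M) : Finite (LocalMonoid e) :=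
  Subtype.finite

instance [Finite M] (e : Idem M) : Finite (MaxSubgroup e) :=
  Finite.of_injective (Units.val : (LocalMonoid e)ˣ → LocalMonoid e) Units.val_injective

lemma MaxSubgroup.val_injective {e : Idem M} :
    Function.Injective (MaxSubgroup.val : MaxSubgroup e → M) :=
  fun _ _ h => Units.ext (Subtype.ext h)

/-- In the finite monoid `eMe` one-sided inverses are two-sided, and `eze` is a left inverse of `x`
there. -/
lemma exists_unit_of_mul_eq [Finite M] {e : Idem M} {x z : M} (h1 : (e : M) * x = x)
    (h2 : x * e = x) (h : z * x = e) : ∃ g : MaxSubgroup e, g.val = x := by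
  let x' : LocalMonoid e := ⟨x, (Subsemigroup.mem_corner_iff e.2).2 ⟨h1, h2⟩⟩
  let z' : LocalMonoid e := ⟨e * z * e, (Subsemigroup.mem_corner_iff e.2).2
    ⟨by rw [← mul_assoc, ← mul_assoc, e.2], by rw [mul_assoc, e.2]⟩⟩
  have h3 : z' * x' = 1 := Subtype.ext (by
    change e * z * e * x = (e : M)
    rw [mul_assoc _ (e : M) x, h1, mul_assoc, h, e.2])
  exact ⟨⟨x', z', mul_eq_one_symm h3, h3⟩, rfl⟩

lemma exists_unit_of_mul_eq' [Finite M] {e : Idem M} {x z : M} (h1 : (e : M) * x = x)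
    (h2 : x * e = x) (h : x * z = e) : ∃ g : MaxSubgroup e, g.val = x := by
  let x' : LocalMonoid e := ⟨x, (Subsemigroup.mem_corner_iff e.2).2 ⟨h1, h2⟩⟩
  let z' : LocalMonoid e := ⟨e * z * e, (Subsemigroup.mem_corner_iff e.2).2
    ⟨by rw [← mul_assoc, ← mul_assoc, e.2], by rw [mul_assoc, e.2]⟩⟩
  have h3 : x' * z' = 1 := Subtype.ext (by
    change x * (e * z * e) = (e : M)
    rw [← mul_assoc, ← mul_assoc, h2, h, e.2])
  exact ⟨⟨x', z', h3, mul_eq_one_symm h3⟩, rfl⟩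

lemma self_mem_LClass (m : M) : m ∈ LClass m := rfl

lemma self_mem_RClass (m : M) : m ∈ RClass m := rfl

lemma LClass.exists_unit [Finite M] {e : Idem M} {x : M} (hx : x ∈ LClass (e : M))
    (h : (e : M) * x = x) : ∃ g : MaxSubgroup e, g.val = x := by
  obtain ⟨z, hz⟩ := (lRel_iff.1 hx).2
  exact exists_unit_of_mul_eq h (LClass.mul_e hx) hz

lemma RClass.exists_unit [Finite M] {e : Idem M} {x : M} (hx : x ∈ RClass (e : M))
    (h : x * (e : M) = x) : ∃ g : MaxSubgroup e, g.val = x := by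
  obtain ⟨z, hz⟩ := (rRel_iff.1 hx).2
  exact exists_unit_of_mul_eq' ((isBiset_RClass e).e_mul hx) h hz

lemma MaxSubgroup.mem_LClass {e : Idem M} (g : MaxSubgroup e) : g.val ∈ LClass (e : M) := by
  have := LClass.mul_G (self_mem_LClass (e : M)) g
  rwa [g.e_mul] at this

lemma MaxSubgroup.mem_RClass {e : Idem M} (g : MaxSubgroup e) : g.val ∈ RClass (e : M) := by
  have := (isBiset_RClass e).G_mul g (self_mem_RClass (e : M))
  rwa [g.mul_e] at this

/-- Replacing `u` by `eue` does not change `xu`, and a left multiplier taking `x'` to `e` makes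
`eue` left invertible in `eMe`, hence a unit. -/
lemma LClass.exists_eq_mul [Finite M] {e : Idem M} {x x' u : M} (hx : x ∈ LClass (e : M))
    (hx' : x' ∈ LClass (e : M)) (h : x' = x * u) : ∃ g : MaxSubgroup e, x' = x * g.val := by
  obtain ⟨z, hz⟩ := (lRel_iff.1 hx').2
  have hxg : x * (e * u * e) = x' := by
    rw [← mul_assoc, ← mul_assoc, LClass.mul_e hx, ← h, LClass.mul_e hx']
  obtain ⟨g, hg⟩ := exists_unit_of_mul_eq (e := e) (x := e * u * e) (z := z * x)
    (by rw [← mul_assoc, ← mul_assoc, e.2]) (by rw [mul_assoc, e.2])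
    (by rw [mul_assoc, hxg, hz])
  exact ⟨g, by rw [hg, hxg]⟩

lemma RClass.exists_eq_mul [Finite M] {e : Idem M} {x x' u : M} (hx : x ∈ RClass (e : M))
    (hx' : x' ∈ RClass (e : M)) (h : x' = u * x) : ∃ g : MaxSubgroup e, x' = g.val * x := by
  obtain ⟨z, hz⟩ := (rRel_iff.1 hx').2
  have hxg : (e * u * e) * x = x' := by
    rw [mul_assoc, (isBiset_RClass e).e_mul hx, mul_assoc, ← h, (isBiset_RClass e).e_mul hx']
  obtain ⟨g, hg⟩ := exists_unit_of_mul_eq' (e := e) (x := e * u * e) (z := x * z)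
    (by rw [← mul_assoc, ← mul_assoc, e.2]) (by rw [mul_assoc, e.2])
    (by rw [← mul_assoc, hxg, hz])
  exact ⟨g, by rw [hg, hxg]⟩

/-! ### `R̃`-classes against `𝓡`-classes; representatives inside a `𝓙`-class. -/

lemma RClass.mem_RTildeClass {m x : M} (hx : x ∈ RClass m) : x ∈ RTildeClass m := by
  obtain ⟨⟨y, hy⟩, ⟨z, hz⟩⟩ := rRel_iff.1 hx
  intro f _
  constructor
  · intro h; rw [← hz, ← mul_assoc, h]
  · intro h; rw [← hy, ← mul_assoc, h]

/-- For regular elements `R̃` is no coarser than `𝓡`: if `zx = f`, then `xz` is an idempotent fixing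
`x`, hence fixing `e`, so `e = x(ze)`. -/
lemma RTildeClass.mem_RClass {e f : Idem M} {x : M} (hx : x ∈ RTildeClass (e : M))
    (hf : x ∈ LClass (f : M)) : x ∈ RClass (e : M) := by
  obtain ⟨z, hz⟩ := (lRel_iff.1 hf).2
  have hxf := LClass.mul_e hf
  have hax : x * z * x = x := by rw [mul_assoc, hz, hxf]
  have hidem : IsIdempotentElem (x * z) := by
    change x * z * (x * z) = x * z
    rw [← mul_assoc, hax]
  refine rRel_iff.2 ⟨⟨x, (hx e e.2).2 e.2⟩, ⟨z * e, ?_⟩⟩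
  rw [← mul_assoc]
  exact (hx _ hidem).1 hax

lemma jRel_of_mem {e f : Idem M} {x : M} (hx : x ∈ RClass (e : M)) (hf : x ∈ LClass (f : M)) :
    JRel (f : M) (e : M) := by
  obtain ⟨⟨y, hy⟩, ⟨z, hz⟩⟩ := rRel_iff.1 hx
  obtain ⟨⟨y', hy'⟩, ⟨z', hz'⟩⟩ := lRel_iff.1 hf
  refine jRel_iff.2 ⟨⟨z', x, ?_⟩, ⟨x, z, ?_⟩⟩
  · rw [mul_assoc, (isBiset_RClass e).e_mul hx, hz']
  · rw [LClass.mul_e hf, hz]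

lemma RClass.subset_JClass {e x : M} (hx : x ∈ RClass e) : x ∈ JClass e := by
  obtain ⟨⟨y, hy⟩, ⟨z, hz⟩⟩ := rRel_iff.1 hx
  exact jRel_iff.2 ⟨⟨1, y, by rw [one_mul, hy]⟩, ⟨1, z, by rw [one_mul, hz]⟩⟩

lemma RClass_eq {x y : M} (h : x ∈ RClass y) : RClass x = RClass y :=
  Set.ext fun _ => ⟨fun hz => Eq.trans hz h, fun hz => Eq.trans hz (Eq.symm h)⟩

/-- If `m = aeb` and `e ∈ MmM`, then `ae` works: stability on the left gives `ae 𝓛 e`, on the right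
`ae 𝓡 aeb`. -/
lemma exists_mem_LClass_inter_RClass [Finite M] {e m : M} (h : m ∈ JClass e) :
    ∃ x, x ∈ LClass e ∧ x ∈ RClass m := by
  obtain ⟨⟨a, b, rfl⟩, ⟨c, d, hc⟩⟩ := jRel_iff.1 h
  refine ⟨a * e, mul_mem_LClass (c := c) (d := b * d) ?_, ?_⟩
  · simpa only [mul_assoc] using hc
  · obtain ⟨n, hn⟩ := exists_mul_pow_eq (f := e) (c := c * a) (d := b * d)
      (by simpa only [mul_assoc] using hc)
    refine rRel_iff.2 ⟨⟨d * (b * d) ^ n, ?_⟩, ⟨b, rfl⟩⟩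
    rw [pow_succ'] at hn
    conv_rhs => rw [← hn]
    simp only [mul_assoc]

lemma exists_mem_RClass_inter_LClass [Finite M] {e m : M} (h : m ∈ JClass e) :
    ∃ x, x ∈ RClass e ∧ x ∈ LClass m := by
  obtain ⟨⟨a, b, rfl⟩, ⟨c, d, hc⟩⟩ := jRel_iff.1 h
  refine ⟨e * b, mul_mem_RClass (c := c * a) (d := d) ?_, ?_⟩
  · simpa only [mul_assoc] using hc
  · obtain ⟨n, hn⟩ := exists_pow_mul_eq (f := e) (c := c * a) (d := b * d)
      (by simpa only [mul_assoc] using hc)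
    refine lRel_iff.2 ⟨⟨(c * a) ^ n * c, ?_⟩, ⟨a, by rw [mul_assoc]⟩⟩
    rw [pow_succ] at hn
    conv_rhs => rw [← hn]
    simp only [mul_assoc]

instance [Finite M] (e : Idem M) : Nonempty (SandwichReps e) := by
  have h1 : ∀ a : RClasses (e : M), ∃ x, x ∈ LClass (e : M) ∩ a.1 := by
    rintro ⟨_, m, hm, rfl⟩
    exact exists_mem_LClass_inter_RClass hm
  have h2 : ∀ b : LClasses (e : M), ∃ x, x ∈ RClass (e : M) ∩ b.1 := by
    rintro ⟨_, m, hm, rfl⟩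
    exact exists_mem_RClass_inter_LClass hm
  choose r hr using h1
  choose l hl using h2
  exact ⟨⟨r, hr, l, hl⟩⟩

lemma SandwichReps.exists_eq_mul_lam [Finite M] {e : Idem M} (s : SandwichReps e) {x : M}
    (hx : x ∈ RClass (e : M)) : ∃ (g : MaxSubgroup e) (b : LClasses (e : M)),
      x = g.val * s.lam b := by
  have h := s.lam_mem ⟨LClass x, Set.mem_image_of_mem _ (RClass.subset_JClass hx)⟩
  obtain ⟨-, y, hy⟩ := lRel_iff.1 (show LRel _ x from h.2)
  obtain ⟨g, hg⟩ := RClass.exists_eq_mul h.1 hx hy.symm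
  exact ⟨g, _, hg⟩

lemma SandwichReps.RClass_rho {e : Idem M} (s : SandwichReps e) (a : RClasses (e : M)) :
    RClass (s.rho a) = a.1 := by
  obtain ⟨_, m, hm, rfl⟩ := a
  exact RClass_eq (s.rho_mem ⟨_, m, hm, rfl⟩).2

end Green

/-! ### The action of a monoid on a module over its monoid algebra -/

section Act

variable (k : Type u) [Field k] {M : Type v} [Monoid M]
  {Y : Type*} [AddCommGroup Y] [Module k Y] [Module (MonoidAlgebra k M) Y]
  [IsScalarTower k (MonoidAlgebra k M) Y]
  {Z : Type*} [AddCommGroup Z] [Module k Z] [Module (MonoidAlgebra k M) Z]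
  [IsScalarTower k (MonoidAlgebra k M) Z]

/-- The action of `m ∈ M` on a `kM`-module, as a `k`-linear map. -/
def act (m : M) : Y →ₗ[k] Y := Algebra.lsmul k k Y (MonoidAlgebra.of k M m)

lemma act_def (m : M) (y : Y) : act k m y = MonoidAlgebra.of k M m • y := rfl

@[simp] lemma act_one (y : Y) : act k (1 : M) y = y := by rw [act_def, map_one, one_smul]

lemma act_mul (m n : M) (y : Y) : act k (m * n) y = act k m (act k n y) := by
  rw [act_def, map_mul, mul_smul]; rfl

lemma map_act (f : Y →ₗ[MonoidAlgebra k M] Z) (m : M) (y : Y) :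
    f (act k m y) = act k m (f y) := f.map_smul _ _

lemma act_mem (N : Submodule (MonoidAlgebra k M) Y) (m : M) {y : Y} (hy : y ∈ N) :
    act k m y ∈ N := N.smul_mem _ hy

lemma coe_act (N : Submodule (MonoidAlgebra k M) Y) (m : M) (y : N) :
    ((act k m y : N) : Y) = act k m (y : Y) := rfl

lemma smul_mem_of_act_mem (N : Submodule k Y) (h : ∀ (m : M), ∀ y ∈ N, act k m y ∈ N)
    (a : MonoidAlgebra k M) {y : Y} (hy : y ∈ N) : a • y ∈ N := by
  induction a using MonoidAlgebra.induction_on with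
  | of m => exact h m y hy
  | add a b ha hb => rw [add_smul]; exact N.add_mem ha hb
  | smul r a ha => rw [smul_assoc]; exact N.smul_mem r ha

/-- A `k`-linear map commuting with the action of `M` is `kM`-linear. -/
def linearMapOfAct (f : Y →ₗ[k] Z) (h : ∀ (m : M) (y : Y), f (act k m y) = act k m (f y)) :
    Y →ₗ[MonoidAlgebra k M] Z where
  toFun := f
  map_add' := f.map_add
  map_smul' a y := by
    rw [RingHom.id_apply]
    induction a using MonoidAlgebra.induction_on with
    | of m => exact h m y
    | add a b ha hb => rw [add_smul, add_smul, map_add, ha, hb]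
    | smul r a ha => rw [smul_assoc, smul_assoc, map_smul, ha]


/-- The subspace spanned by the orbit of a vector. -/
lemma mem_span_act (y : Y) (a : MonoidAlgebra k M) :
    a • y ∈ Submodule.span k (Set.range fun m : M => act k m y) := by
  refine smul_mem_of_act_mem k _ (fun m z hz => ?_) a (Submodule.subset_span ⟨1, act_one k y⟩)
  refine Submodule.span_induction ?_ ?_ ?_ ?_ hz
  · rintro _ ⟨n, rfl⟩
    exact Submodule.subset_span ⟨m * n, act_mul k m n y⟩
  · rw [map_zero]; exact Submodule.zero_mem _
  · intro x y _ _ hx hy; rw [map_add]; exact Submodule.add_mem _ hx hy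
  · intro c x _ hx; rw [map_smul]; exact Submodule.smul_mem _ c hx

lemma mem_span_act_of_isSimple [IsSimpleModule (MonoidAlgebra k M) Y] {y : Y} (hy : y ≠ 0)
    (z : Y) : z ∈ Submodule.span k (Set.range fun m : M => act k m y) := by
  obtain ⟨a, rfl⟩ := IsSimpleModule.toSpanSingleton_surjective (MonoidAlgebra k M) hy z
  exact mem_span_act k y a

/-! ### Apexes of simple modules. -/

/-- An idempotent `e` is an apex of a module `Y` if it does not annihilate `Y` and each element of
`MeM` not annihilating `Y` is `𝓙`-equivalent to `e`. -/
structure IsApex (Y : Type*) [AddCommGroup Y] [Module k Y] [Module (MonoidAlgebra k M) Y]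
    [IsScalarTower k (MonoidAlgebra k M) Y] (e : Idem M) : Prop where
  exists_ne : ∃ y : Y, act k (e : M) y ≠ 0
  exists_eq : ∀ (a b : M) (y : Y), act k (a * e * b) y ≠ 0 → ∃ c d, c * (a * e * b) * d = e

lemma IsApex.mul_mem_LClass [Finite M] {e : Idem M} (h : IsApex k Y e) {m : M} {y : Y}
    (hm : act k (m * e) y ≠ 0) : m * e ∈ LClass (e : M) := by
  obtain ⟨c, d, hcd⟩ := h.exists_eq m 1 y (by rwa [mul_one])
  exact FountainMonoid.mul_mem_LClass (c := c) (d := d) (by rwa [mul_one] at hcd)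

lemma IsApex.mul_mem_RClass [Finite M] {e : Idem M} (h : IsApex k Y e) {m : M} {y : Y}
    (hm : act k (e * m) y ≠ 0) : e * m ∈ RClass (e : M) := by
  obtain ⟨c, d, hcd⟩ := h.exists_eq 1 m y (by rwa [one_mul])
  exact FountainMonoid.mul_mem_RClass (c := c) (d := d) (by rwa [one_mul] at hcd)

/-- Take `m₀` not annihilating `Y` with `Mm₀M` as small as possible. Any multiple of `m₀` that still
acts nontrivially is `𝓙`-equivalent to `m₀`; simplicity makes some `m₀xm₀` such a multiple, and this
produces an idempotent in the class. -/
lemma exists_isApex [Finite M] {n : ℕ} (e : Fin n → Idem M)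
    (he : ∀ f : Idem M, ∃! i, JRel (f : M) (e i : M)) [IsSimpleModule (MonoidAlgebra k M) Y] :
    ∃ j, IsApex k Y (e j) := by
  have hnt : Nontrivial Y := IsSimpleModule.nontrivial (MonoidAlgebra k M) Y
  obtain ⟨y₀, hy₀⟩ := exists_ne (0 : Y)
  obtain ⟨m₀, ⟨s, hs⟩, hmin⟩ := Set.exists_min_image {m : M | ∃ y : Y, act k m y ≠ 0}
    (fun m => (Set.range (fun p : M × M => p.1 * m * p.2)).ncard) (Set.toFinite _)
    ⟨1, y₀, by rwa [act_one]⟩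
  have hJ : ∀ (a b : M) (y : Y), act k (a * m₀ * b) y ≠ 0 → JRel (a * m₀ * b) m₀ := by
    intro a b y hy
    refine Set.eq_of_subset_of_ncard_le ?_ (hmin _ ⟨y, hy⟩) (Set.toFinite _)
    rintro _ ⟨p, rfl⟩
    exact ⟨(p.1 * a, b * p.2), by simp only [mul_assoc]⟩
  obtain ⟨x, s', hx⟩ : ∃ (x : M) (s' : Y), act k (m₀ * x * m₀) s' ≠ 0 := by
    by_contra! hcon
    obtain ⟨z, hz⟩ : ∃ z : Y, act k m₀ z ≠ 0 := ⟨s, hs⟩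
    refine hz ?_
    -- The orbit of `m₀s ≠ 0` spans `Y`, so if every `m₀xm₀` acted as zero then `m₀` would too.
    have := mem_span_act_of_isSimple (M := M) k hs z
    refine Submodule.span_induction ?_ ?_ ?_ ?_ this
    · rintro _ ⟨n, rfl⟩
      simpa only [act_mul] using hcon n s
    · exact map_zero _
    · intro x y _ _ hx hy; rw [map_add, hx, hy, add_zero]
    · intro c x _ hx; rw [map_smul, hx, smul_zero]
  obtain ⟨-, c, d, hcd⟩ := jRel_iff.1 (hJ 1 (x * m₀) s' (by simpa only [one_mul, ← mul_assoc] using hx))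
  -- From `m₀ = (c m₀ x) m₀ d`, no power of `c m₀ x` annihilates `Y`; by minimality its idempotent
  -- power lies in the `𝓙`-class of `m₀`.
  obtain ⟨r, hr⟩ := exists_idempotent_pow (c * m₀ * x)
  have h1 := pow_mul_mul_pow (f := m₀) (c := c * m₀ * x) (d := d)
    (by simpa only [mul_assoc, one_mul] using hcd) (r + 1)
  have h2 : ∃ y : Y, act k ((c * m₀ * x) ^ (r + 1)) y ≠ 0 := by
    refine ⟨act k (m₀ * d ^ (r + 1)) s, ?_⟩
    rwa [← act_mul, ← mul_assoc, h1]
  obtain ⟨y, hy⟩ := h2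
  have h3 : (c * m₀ * x) ^ (r + 1) = ((c * m₀ * x) ^ r * c) * m₀ * x := by
    rw [pow_succ]; simp only [mul_assoc]
  have h4 : JRel ((c * m₀ * x) ^ (r + 1)) m₀ := by
    rw [h3] at hy ⊢
    exact hJ _ _ y hy
  obtain ⟨j, hj, -⟩ := he ⟨_, hr⟩
  have hj' : JRel (e j : M) m₀ := Eq.trans (Eq.symm hj) h4
  obtain ⟨⟨a, b, hab⟩, ⟨a', b', hab'⟩⟩ := jRel_iff.1 hj'
  refine ⟨j, ⟨⟨act k b' s, fun h => hs ?_⟩, fun p q y hy => ?_⟩⟩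
  · rw [← hab', act_mul, act_mul, h, map_zero]
  · have h5 : p * (e j : M) * q = (p * a) * m₀ * (b * q) := by
      rw [← hab]; simp only [mul_assoc]
    have h6 : JRel (p * (e j : M) * q) (e j : M) := by
      refine Eq.trans ?_ hj'.symm
      rw [h5] at hy ⊢
      exact hJ _ _ y hy
    exact (jRel_iff.1 h6).2

lemma isIrreducible_of {G V : Type*} [Monoid G] [AddCommGroup V] [Module k V]
    (ρ : Representation k G V) [Nontrivial V]
    (h : ∀ (N : Subrepresentation ρ) (w : V), w ∈ N.toSubmodule → w ≠ 0 → N.toSubmodule = ⊤) :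
    ρ.IsIrreducible where
  exists_pair_ne := ⟨⊥, ⊤, fun hb =>
    bot_ne_top (congrArg Subrepresentation.toSubmodule hb : (⊥ : Submodule k V) = ⊤)⟩
  eq_bot_or_eq_top N := by
    by_cases hN : N.toSubmodule = ⊥
    · exact Or.inl (Subrepresentation.toSubmodule_injective hN)
    · obtain ⟨w, hw, hw0⟩ := (Submodule.ne_bot_iff _).1 hN
      exact Or.inr (Subrepresentation.toSubmodule_injective (h N w hw hw0))

/-! ### The `G_e`-module `eY`. -/

variable (Y) in
/-- The subspace `eY`. -/
abbrev corner (e : M) : Submodule k Y := LinearMap.range (act k e : Y →ₗ[k] Y)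

lemma mem_corner_iff {e : Idem M} {y : Y} : y ∈ corner k Y (e : M) ↔ act k (e : M) y = y := by
  constructor
  · rintro ⟨z, rfl⟩
    rw [← act_mul, e.2]
  · intro h
    exact ⟨y, h⟩

variable (Y) in
/-- The representation of `G_e` on `eY`. -/
def cornerRep (e : Idem M) : Representation k (MaxSubgroup e) (corner k Y (e : M)) where
  toFun g := (act k g.val).restrict fun y _ => ⟨act k g.val y, by rw [← act_mul, g.e_mul]⟩
  map_one' := LinearMap.ext fun y => Subtype.ext ((mem_corner_iff k).1 y.2)
  map_mul' g h := LinearMap.ext fun y => Subtype.ext (act_mul k g.val h.val y.1)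

lemma IsApex.nontrivial {e : Idem M} (h : IsApex k Y e) : Nontrivial (corner k Y (e : M)) := by
  obtain ⟨y, hy⟩ := h.exists_ne
  exact nontrivial_of_ne ⟨act k (e : M) y, y, rfl⟩ 0 fun h => hy (congrArg Subtype.val h)

/-- A nonzero `w ∈ eY` generates `Y`, so the `emw = (eme)w` span `eY`; at an apex such a vector
vanishes unless `eme ∈ G_e`. -/
lemma IsApex.cornerRep_isIrreducible [Finite M] [IsSimpleModule (MonoidAlgebra k M) Y]
    {e : Idem M} (h : IsApex k Y e) : (cornerRep k Y e).IsIrreducible := by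
  have := h.nontrivial
  refine isIrreducible_of k _ fun N w hw hw0 => ?_
  rw [eq_top_iff]
  rintro z -
  have hw1 : (w : Y) ≠ 0 := fun h => hw0 (Subtype.ext h)
  have hN : ∀ y ∈ Submodule.span k (Set.range fun m : M => act k m (w : Y)),
      act k (e : M) y ∈ N.toSubmodule.map (corner k Y (e : M)).subtype := by
    intro y hy
    refine Submodule.span_induction ?_ ?_ ?_ ?_ hy
    · rintro _ ⟨m, rfl⟩
      dsimp only
      by_cases h0 : act k (e : M) (act k m (w : Y)) = 0
      · rw [h0]; exact Submodule.zero_mem _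
      · have hwe := (mem_corner_iff k).1 w.2
        have h1 : act k (e : M) (act k m (w : Y)) = act k (e * m * e) (w : Y) := by
          rw [act_mul, act_mul, hwe]
        have h2 := h.mul_mem_LClass k (m := e * m) (h1 ▸ h0)
        obtain ⟨g, hg⟩ := LClass.exists_unit h2 (by rw [← mul_assoc, ← mul_assoc, e.2])
        rw [h1, ← hg]
        exact ⟨_, N.apply_mem_toSubmodule g hw, rfl⟩
    · rw [map_zero]; exact Submodule.zero_mem _
    · intro x y _ _ hx hy; rw [map_add]; exact Submodule.add_mem _ hx hy
    · intro c x _ hx; rw [map_smul]; exact Submodule.smul_mem _ c hx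
  obtain ⟨z', hz', hzz⟩ := hN z (mem_span_act_of_isSimple k hw1 z)
  rw [(mem_corner_iff k).1 z.2] at hzz
  have : z' = z := Subtype.ext hzz
  rwa [← this]

end Act

section AsModule

variable {k : Type u} [Field k] {M : Type v} [Monoid M] {V : Type*} [AddCommGroup V] [Module k V]

lemma act_asModule (ρ : Representation k M V) (m : M) (x : ρ.asModule) :
    act k m x = (ρ.asModuleEquiv.symm (ρ m (ρ.asModuleEquiv x))) := by
  rw [Representation.asModuleEquiv_symm_map_rho]; rfl

end AsModule

/-! ### Linear algebra -/

section LinearAlgebra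

variable {k : Type*} [Field k] {Y : Type*} [AddCommGroup Y] [Module k Y]

lemma finrank_finset_sup_le [Module.Finite k Y] {ι : Type*} (s : Finset ι)
    (C : ι → Submodule k Y) :
    Module.finrank k (s.sup C : Submodule k Y) ≤ ∑ i ∈ s, Module.finrank k (C i) := by
  classical
  induction s using Finset.induction_on with
  | empty => simp
  | insert a s ha ih =>
    rw [Finset.sup_insert, Finset.sum_insert ha]
    exact (Submodule.finrank_add_le_finrank_add_finrank _ _).trans (by omega)

lemma finrank_eq_inf_ker_add_map [Module.Finite k Y] {Z : Type*} [AddCommGroup Z] [Module k Z]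
    (f : Y →ₗ[k] Z) (W : Submodule k Y) :
    Module.finrank k W =
      Module.finrank k (W ⊓ LinearMap.ker f : Submodule k Y) + Module.finrank k (W.map f) := by
  have h := LinearMap.finrank_range_add_finrank_ker (f.domRestrict W)
  rw [LinearMap.range_domRestrict, LinearMap.ker_domRestrict,
    ← Submodule.finrank_map_subtype_eq W, Submodule.map_comap_subtype] at h
  omega

lemma finrank_map_of_injective {Z : Type*} [AddCommGroup Z] [Module k Z]
    (f : Y →ₗ[k] Z) (hf : Function.Injective f) (W : Submodule k Y) :
    Module.finrank k (W.map f) = Module.finrank k W :=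
  (Submodule.equivMapOfInjective f hf W).finrank_eq.symm

lemma exists_isCompl_in [Module.Finite k Y] {B W : Submodule k Y} (h : B ≤ W) :
    ∃ C : Submodule k Y, C ⊔ B = W ∧
      Module.finrank k C + Module.finrank k B = Module.finrank k W := by
  obtain ⟨C', hC'⟩ := Submodule.exists_isCompl B
  have h1 : (C' ⊓ W) ⊔ B = W := by
    rw [sup_comm, ← sup_inf_assoc_of_le C' h, hC'.sup_eq_top, top_inf_eq]
  refine ⟨C' ⊓ W, h1, ?_⟩
  have h2 := Submodule.finrank_sup_add_finrank_inf_eq (C' ⊓ W) B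
  have h3 : C' ⊓ W ⊓ B = ⊥ := by
    rw [eq_bot_iff, ← hC'.inf_eq_bot]
    exact le_inf inf_le_right (inf_le_left.trans inf_le_left)
  rw [h1, h3, finrank_bot] at h2
  omega

/-- As `f` kills `N ∩ B`, it factors through the image of `N` in `Y ⧸ B`, and a linear map extends
from that subspace. -/
lemma exists_extend_of_inf_le_ker {V : Type*} [AddCommGroup V] [Module k V]
    (N B : Submodule k Y) (f : N →ₗ[k] V) (hf : ∀ x : N, (x : Y) ∈ B → f x = 0) :
    ∃ F : Y →ₗ[k] V, (∀ x : N, F x = f x) ∧ ∀ y ∈ B, F y = 0 := by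
  let p : N →ₗ[k] Y ⧸ B := B.mkQ ∘ₗ N.subtype
  obtain ⟨s, hs⟩ := p.rangeRestrict.exists_rightInverse_of_surjective p.range_rangeRestrict
  obtain ⟨h, hh⟩ := (f ∘ₗ s).exists_extend
  refine ⟨h ∘ₗ B.mkQ, fun x => ?_, fun y hy => ?_⟩
  · have h1 : h (p x) = f (s (p.rangeRestrict x)) :=
      LinearMap.congr_fun hh (p.rangeRestrict x)
    have h2 : p (s (p.rangeRestrict x)) = p x :=
      congrArg Subtype.val (LinearMap.congr_fun hs (p.rangeRestrict x))
    have h3 : ((s (p.rangeRestrict x) - x : N) : Y) ∈ B := by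
      rw [← Submodule.Quotient.mk_eq_zero]
      change p (s (p.rangeRestrict x) - x) = 0
      rw [map_sub, h2, sub_self]
    have h4 := hf _ h3
    rw [map_sub, sub_eq_zero] at h4
    exact h1.trans h4
  · rw [LinearMap.comp_apply, Submodule.mkQ_apply, (Submodule.Quotient.mk_eq_zero B).2 hy, map_zero]

end LinearAlgebra

/-! ### The subspaces `eY` and the subspaces spanned by the `mY` with `m ∈ eM \ R̃_e` -/

section Below

variable (k : Type u) [Field k] {M : Type v} [Monoid M]
  (Y : Type*) [AddCommGroup Y] [Module k Y] [Module (MonoidAlgebra k M) Y]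
  [IsScalarTower k (MonoidAlgebra k M) Y]
  {Z : Type*} [AddCommGroup Z] [Module k Z] [Module (MonoidAlgebra k M) Z]
  [IsScalarTower k (MonoidAlgebra k M) Z]

/-- The subspace of `eY` spanned by the elements `my` with `m ∈ eM \ R̃_e`. -/
def below (e : M) : Submodule k Y :=
  Submodule.span k {z | ∃ (m : M) (y : Y), e * m = m ∧ m ∉ RTildeClass e ∧ act k m y = z}

variable {Y}

lemma act_mem_below {e m : M} (h1 : e * m = m) (h2 : m ∉ RTildeClass e) (y : Y) :
    act k m y ∈ below k Y e := Submodule.subset_span ⟨m, y, h1, h2, rfl⟩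

lemma below_le_corner (e : M) : below k Y e ≤ corner k Y e := by
  refine Submodule.span_le.2 ?_
  rintro _ ⟨m, y, h1, -, rfl⟩
  exact ⟨act k m y, by rw [← act_mul, h1]⟩

lemma map_below (f : Y →ₗ[MonoidAlgebra k M] Z) (g : Y →ₗ[k] Z) (hfg : ∀ y, g y = f y)
    (hf : Function.Surjective f) (e : M) : (below k Y e).map g = below k Z e := by
  rw [below, Submodule.map_span, below]
  congr 1
  ext z
  constructor
  · rintro ⟨_, ⟨m, y, h1, h2, rfl⟩, rfl⟩
    exact ⟨m, f y, h1, h2, by rw [hfg, map_act]⟩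
  · rintro ⟨m, z, h1, h2, rfl⟩
    obtain ⟨y, rfl⟩ := hf z
    exact ⟨_, ⟨m, y, h1, h2, rfl⟩, by rw [hfg, map_act]⟩

lemma map_corner (f : Y →ₗ[MonoidAlgebra k M] Z) (g : Y →ₗ[k] Z) (hfg : ∀ y, g y = f y)
    (hf : Function.Surjective f) (e : M) : (corner k Y e).map g = corner k Z e := by
  ext z
  constructor
  · rintro ⟨_, ⟨y, rfl⟩, rfl⟩
    exact ⟨f y, by rw [hfg, map_act]⟩
  · rintro ⟨z, rfl⟩
    obtain ⟨y, rfl⟩ := hf z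
    exact ⟨_, ⟨y, rfl⟩, by rw [hfg, map_act]⟩

variable (N : Submodule (MonoidAlgebra k M) Y)

lemma map_subtype_below_le (e : M) :
    (below k N e).map (N.subtype.restrictScalars k) ≤ below k Y e ⊓ N.restrictScalars k := by
  rw [below, Submodule.map_span, Submodule.span_le]
  rintro _ ⟨_, ⟨m, y, h1, h2, rfl⟩, rfl⟩
  exact ⟨act_mem_below k h1 h2 (y : Y), (act k m y).2⟩

lemma map_subtype_corner (e : Idem M) :
    (corner k N (e : M)).map (N.subtype.restrictScalars k) =
      corner k Y (e : M) ⊓ N.restrictScalars k := by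
  ext z
  constructor
  · rintro ⟨_, ⟨y, rfl⟩, rfl⟩
    exact ⟨⟨(y : Y), rfl⟩, (act k (e : M) y).2⟩
  · rintro ⟨h1, h2⟩
    exact ⟨⟨z, h2⟩, (mem_corner_iff k).2 (Subtype.ext ((mem_corner_iff k).1 h1)), rfl⟩

lemma finrank_corner [Module.Finite k Y] (e : Idem M) :
    Module.finrank k (corner k Y (e : M)) = Module.finrank k (corner k N (e : M)) +
      Module.finrank k (corner k (Y ⧸ N) (e : M)) := by
  have h := finrank_eq_inf_ker_add_map (N.mkQ.restrictScalars k) (corner k Y (e : M))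
  rw [map_corner k N.mkQ (N.mkQ.restrictScalars k) (fun _ => rfl) N.mkQ_surjective] at h
  have h2 : LinearMap.ker (N.mkQ.restrictScalars k) = N.restrictScalars k := by
    ext; simp
  rwa [h2, ← map_subtype_corner, finrank_map_of_injective _ N.injective_subtype] at h

lemma finrank_below [Module.Finite k Y] (e : Idem M) :
    Module.finrank k (below k Y (e : M)) =
      Module.finrank k (below k Y (e : M) ⊓ N.restrictScalars k : Submodule k Y) +
      Module.finrank k (below k (Y ⧸ N) (e : M)) := by
  have h := finrank_eq_inf_ker_add_map (N.mkQ.restrictScalars k) (below k Y (e : M))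
  rw [map_below k N.mkQ (N.mkQ.restrictScalars k) (fun _ => rfl) N.mkQ_surjective] at h
  have h2 : LinearMap.ker (N.mkQ.restrictScalars k) = N.restrictScalars k := by
    ext; simp
  rwa [h2] at h

/-- Elements of `below Y` lying in `N` may involve vectors outside `N`, hence only an inequality;
`SimpleBound.inf_le` turns it into an equality. -/
lemma finrank_below_le [Module.Finite k Y] (e : Idem M) :
    Module.finrank k (below k N (e : M)) ≤
      Module.finrank k (below k Y (e : M) ⊓ N.restrictScalars k : Submodule k Y) := by
  rw [← finrank_map_of_injective (N.subtype.restrictScalars k) N.injective_subtype]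
  exact Submodule.finrank_mono (map_subtype_below_le k N (e : M))

/-- Here `eM = fM` and the `R̃`-classes agree. This lets an arbitrary idempotent be replaced by the
chosen representative. -/
lemma below_congr {e f : M} (h : RRel e f) (he : IsIdempotentElem e) (hf : IsIdempotentElem f) :
    below k Y e = below k Y f := by
  have h1 : RTildeClass e = RTildeClass f := by
    have h2 := RClass.mem_RTildeClass (show e ∈ RClass f from h)
    ext x
    exact ⟨fun hx g hg => (hx g hg).trans (h2 g hg), fun hx g hg => (hx g hg).trans (h2 g hg).symm⟩
  obtain ⟨⟨a, ha⟩, ⟨b, hb⟩⟩ := rRel_iff.1 h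
  have h3 : ∀ m, e * m = m ↔ f * m = m := by
    intro m
    constructor
    · intro h; rw [← h, ← mul_assoc, ← ha, ← mul_assoc f f, hf]
    · intro h; rw [← h, ← mul_assoc, ← hb, ← mul_assoc e e, he]
  simp only [below, h1, h3]

end Below

/-! ### Comparing dimensions -/

section Count

variable (k : Type u) [Field k] {M : Type v} [Monoid M]

variable (M) in
/-- A choice of idempotent representatives of the `R̃`-classes. -/
structure RTildeReps (ι : Type*) where
  rep : ι → Idem M
  exists_mem : ∀ m : M, ∃ q, m ∈ RTildeClass (rep q : M)
  inj : ∀ q q', RTildeRel (rep q : M) (rep q') → q = q'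

variable (M) in
lemma exists_rTildeReps [IsLeftFountain M] :
    Nonempty (RTildeReps M (Set.range (RTildeClass : M → Set M))) := by
  have h : ∀ q : Set.range (RTildeClass : M → Set M), ∃ e : Idem M, (e : M) ∈ q.1 := by
    rintro ⟨_, m, rfl⟩
    obtain ⟨e, he, he'⟩ := IsLeftFountain.exists_idempotent m
    exact ⟨⟨e, he'⟩, he⟩
  choose ε hε using h
  have key : ∀ q m, m ∈ RTildeClass (ε q : M) ↔ m ∈ q.1 := by
    rintro ⟨_, n, rfl⟩ m
    have h1 : RTildeRel (ε ⟨_, n, rfl⟩ : M) n := hε ⟨_, n, rfl⟩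
    exact ⟨fun h f hf => (h f hf).trans (h1 f hf), fun h f hf => (h f hf).trans (h1 f hf).symm⟩
  refine ⟨⟨ε, fun m => ⟨⟨_, m, rfl⟩, (key _ _).2 fun _ _ => Iff.rfl⟩, fun q q' h => ?_⟩⟩
  refine Subtype.ext (Set.ext fun x => ?_)
  rw [← key, ← key]
  exact ⟨fun hx f hf => (hx f hf).trans (h f hf), fun hx f hf => (hx f hf).trans (h f hf).symm⟩

variable {ι : Type*} [Fintype ι] (R : RTildeReps M ι)

/-- Complements `C q` of `below` in the corners together span `Y`. Indeed an `m ∈ e_qM \ R̃_{e_q}`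
satisfies `m = e_q'm` for a representative with `e_q'M` strictly smaller, so induction on the size
of `e_qM` puts each `e_qY` in their sum. -/
lemma finrank_add_sum_below_le [Finite M] (Y : Type*) [AddCommGroup Y] [Module k Y]
    [Module (MonoidAlgebra k M) Y] [IsScalarTower k (MonoidAlgebra k M) Y] [Module.Finite k Y] :
    Module.finrank k Y + ∑ q, Module.finrank k (below k Y (R.rep q : M)) ≤
      ∑ q, Module.finrank k (corner k Y (R.rep q : M)) := by
  choose C hC hC' using fun q => exists_isCompl_in (below_le_corner k (Y := Y) (R.rep q : M))
  have key : ∀ (n : ℕ) (q : ι), (Set.range (fun m : M => (R.rep q : M) * m)).ncard = n →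
      corner k Y (R.rep q : M) ≤ Finset.univ.sup C := by
    intro n
    induction n using Nat.strong_induction_on with
    | _ n ih =>
      intro q hq
      rw [← hC q]
      refine sup_le (Finset.le_sup (f := C) (Finset.mem_univ q)) (Submodule.span_le.2 ?_)
      rintro _ ⟨m, y, h1, h2, rfl⟩
      obtain ⟨q', hq'⟩ := R.exists_mem m
      have h3 : (R.rep q' : M) * m = m := (hq' _ (R.rep q').2).2 (R.rep q').2
      have h4 : (R.rep q : M) * R.rep q' = R.rep q' := (hq' _ (R.rep q).2).1 h1
      refine ih _ ?_ q' rfl ⟨act k m y, by rw [← act_mul, h3]⟩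
      rw [← hq]
      -- Equality of the right ideals would make `m` an element of `R̃_{e_q}`, which was excluded.
      refine Set.ncard_lt_ncard (Set.ssubset_iff_subset_ne.2 ⟨?_, fun h5 => h2 ?_⟩) (Set.toFinite _)
      · rintro _ ⟨x, rfl⟩
        exact ⟨R.rep q' * x, by dsimp only; rw [← mul_assoc, h4]⟩
      · have h6 := RClass.mem_RTildeClass (show (R.rep q' : M) ∈ RClass (R.rep q : M) from h5)
        exact fun f hf => (hq' f hf).trans (h6 f hf)
  have htop : Finset.univ.sup C = (⊤ : Submodule k Y) := by
    rw [eq_top_iff]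
    rintro y -
    -- The representative of the class of `1` is `1` itself, and its corner is all of `Y`.
    obtain ⟨q, hq⟩ := R.exists_mem 1
    have h1 : (R.rep q : M) * 1 = 1 := (hq _ (R.rep q).2).2 (R.rep q).2
    rw [mul_one] at h1
    exact key _ q rfl ⟨y, by rw [h1, act_one]⟩
  have h := finrank_finset_sup_le Finset.univ C
  rw [htop, finrank_top] at h
  calc _ ≤ ∑ q, Module.finrank k (C q) + ∑ q, Module.finrank k (below k Y (R.rep q : M)) := by
        gcongr
    _ = _ := by rw [← Finset.sum_add_distrib]; exact Finset.sum_congr rfl fun q _ => hC' q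

/-- The subspaces `eY` are as small as possible for simple modules `Y`. -/
def SimpleBound : Prop :=
  ∀ (S : Type w) [AddCommGroup S] [Module k S] [Module (MonoidAlgebra k M) S]
    [IsScalarTower k (MonoidAlgebra k M) S] [Module.Finite k S],
    IsSimpleModule (MonoidAlgebra k M) S →
    ∑ q, Module.finrank k (corner k S (R.rep q : M)) ≤
      Module.finrank k S + ∑ q, Module.finrank k (below k S (R.rep q : M))

variable {k}

lemma exists_isSimpleModule_le [Finite M] {Y : Type*} [AddCommGroup Y]
    [Module (MonoidAlgebra k M) Y] {N : Submodule (MonoidAlgebra k M) Y} (hN : N ≠ ⊥) :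
    ∃ S ≤ N, IsSimpleModule (MonoidAlgebra k M) S := by
  have : IsArtinianRing (MonoidAlgebra k M) := IsArtinianRing.of_finite k _
  obtain ⟨y, hyN, hy⟩ := (Submodule.ne_bot_iff N).1 hN
  let P := Submodule.span (MonoidAlgebra k M) {y}
  have hP : Nontrivial P := nontrivial_of_ne ⟨y, Submodule.mem_span_singleton_self y⟩ 0
    fun h => hy (congrArg Subtype.val h)
  obtain ⟨a, ha, -⟩ := (eq_bot_or_exists_atom_le (⊤ : Submodule (MonoidAlgebra k M) P)).resolve_left
    top_ne_bot
  have hs : IsSimpleModule (MonoidAlgebra k M) a := isSimpleModule_iff_isAtom.2 ha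
  refine ⟨a.map P.subtype, (Submodule.map_subtype_le P a).trans
    ((Submodule.span_singleton_le_iff_mem y N).2 hyN), IsSimpleModule.congr (N := a)
    (Submodule.equivMapOfInjective P.subtype P.injective_subtype a).symm⟩

/-- Split off a simple submodule: dimensions of `Y` and of its corners are additive, while `dim
below` is superadditive, so the bound survives extensions. -/
lemma SimpleBound.sum_corner_le [Finite M] {R : RTildeReps M ι} (H : SimpleBound.{u, v, w} k R) :
    ∀ (d : ℕ) (Y : Type w) [AddCommGroup Y] [Module k Y] [Module (MonoidAlgebra k M) Y]
    [IsScalarTower k (MonoidAlgebra k M) Y] [Module.Finite k Y], Module.finrank k Y = d →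
    ∑ q, Module.finrank k (corner k Y (R.rep q : M)) ≤
      Module.finrank k Y + ∑ q, Module.finrank k (below k Y (R.rep q : M)) := by
  intro d
  induction d using Nat.strong_induction_on with
  | _ d ih =>
    intro Y _ _ _ _ _ hd
    rcases subsingleton_or_nontrivial Y with hY | hY
    · have h1 : ∀ q, Module.finrank k (corner k Y (R.rep q : M)) = 0 := fun q =>
        Module.finrank_zero_of_subsingleton
      simp [h1]
    · obtain ⟨N, -, hN⟩ := exists_isSimpleModule_le (k := k) (M := M) (Y := Y) top_ne_bot
      have hNY : Module.Finite k N := inferInstanceAs (Module.Finite k (N.restrictScalars k))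
      have hnt := IsSimpleModule.nontrivial (MonoidAlgebra k M) N
      have hpos : 0 < Module.finrank k N := Module.finrank_pos
      have hadd : Module.finrank k (Y ⧸ N) + Module.finrank k N = Module.finrank k Y :=
        Submodule.finrank_quotient_add_finrank (N.restrictScalars k)
      have h1 := H N hN
      have h2 := ih (Module.finrank k (Y ⧸ N)) (by omega) (Y ⧸ N) rfl
      have h3 : ∑ q, Module.finrank k (below k N (R.rep q : M)) ≤
          ∑ q, Module.finrank k (below k Y (R.rep q : M) ⊓ N.restrictScalars k : Submodule k Y) :=
        Finset.sum_le_sum fun q _ => finrank_below_le k N (R.rep q)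
      simp only [finrank_corner k N, finrank_below k N, Finset.sum_add_distrib]
      omega

/-- The upper bounds for `N` and `Y ⧸ N` add up against the lower bound for `Y`, leaving no slack:
the termwise inequalities `dim below N ≤ dim (below Y ∩ N)` have equal sums, so each is an equality.
-/
lemma SimpleBound.inf_le [Finite M] {R : RTildeReps M ι} (H : SimpleBound.{u, v, w} k R)
    {Y : Type w} [AddCommGroup Y] [Module k Y] [Module (MonoidAlgebra k M) Y]
    [IsScalarTower k (MonoidAlgebra k M) Y] [Module.Finite k Y]
    (N : Submodule (MonoidAlgebra k M) Y) (q : ι) :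
    below k Y (R.rep q : M) ⊓ N.restrictScalars k =
      (below k N (R.rep q : M)).map (N.subtype.restrictScalars k) := by
  have hNY : Module.Finite k N := inferInstanceAs (Module.Finite k (N.restrictScalars k))
  have hadd : Module.finrank k (Y ⧸ N) + Module.finrank k N = Module.finrank k Y :=
    Submodule.finrank_quotient_add_finrank (N.restrictScalars k)
  have h1 := finrank_add_sum_below_le k R Y
  have h2 := H.sum_corner_le _ N rfl
  have h3 := H.sum_corner_le _ (Y ⧸ N) rfl
  simp only [finrank_corner k N, finrank_below k N, Finset.sum_add_distrib] at h1
  have h4 : ∀ q ∈ Finset.univ, Module.finrank k (below k N (R.rep q : M)) ≤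
      Module.finrank k (below k Y (R.rep q : M) ⊓ N.restrictScalars k : Submodule k Y) :=
    fun q _ => finrank_below_le k N (R.rep q)
  have h5 := (Finset.sum_eq_sum_iff_of_le h4).1 (le_antisymm (Finset.sum_le_sum h4) (by omega)) q
    (Finset.mem_univ q)
  refine (Submodule.eq_of_le_of_finrank_eq (map_subtype_below_le k N _) ?_).symm
  rw [finrank_map_of_injective _ N.injective_subtype, h5]

end Count

/-! ### Sandwich matrices and simple modules -/

section Sandwich

variable {k : Type u} [Field k] {M : Type v} [Monoid M]

open Classical in
lemma sandwichMatrix_apply_of_eq {e : Idem M} (s : SandwichReps e) {b : LClasses (e : M)}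
    {a : RClasses (e : M)} {g : MaxSubgroup e} (h : g.val = s.lam b * s.rho a) :
    sandwichMatrix k s b a = MonoidAlgebra.single g 1 := by
  have hex : ∃ g : MaxSubgroup e, g.val = s.lam b * s.rho a := ⟨g, h⟩
  rw [sandwichMatrix, dif_pos hex, MaxSubgroup.val_injective (hex.choose_spec.trans h.symm)]

open Classical in
lemma sandwichMatrix_apply_of_not {e : Idem M} (s : SandwichReps e) {b : LClasses (e : M)}
    {a : RClasses (e : M)} (h : ¬ ∃ g : MaxSubgroup e, g.val = s.lam b * s.rho a) :
    sandwichMatrix k s b a = 0 := dif_neg h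

open Classical in
lemma IsLeftInvertible.eq_zero {A B S : Type*} [Ring S] [Fintype A] [Finite B]
    {P : Matrix B A S} (hP : IsLeftInvertible P) {V : Type*} [AddCommGroup V] [Module k V]
    (α : S →+* Module.End k V) (v : A → V) (hv : ∀ b, ∑ a, α (P b a) (v a) = 0) : v = 0 := by
  let := Fintype.ofFinite B
  obtain ⟨Q, hQ⟩ := hP
  funext a
  have h1 : ∑ a', α ((Q * P) a a') (v a') = 0 := by
    have h2 : ∀ a', α ((Q * P) a a') (v a') = ∑ b, α (Q a b) (α (P b a') (v a')) := fun a' => by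
      rw [Matrix.mul_apply, map_sum, LinearMap.sum_apply]
      exact Finset.sum_congr rfl fun b _ => by rw [map_mul]; rfl
    rw [Finset.sum_congr rfl fun a' _ => h2 a', Finset.sum_comm]
    exact Finset.sum_eq_zero fun b _ => by rw [← map_sum, hv, map_zero]
  rw [hQ, Finset.sum_eq_single a] at h1
  · simpa using h1
  · intro a' _ ha'
    simp [Matrix.one_apply_ne ha'.symm]
  · simp

variable {Y : Type*} [AddCommGroup Y] [Module k Y] [Module (MonoidAlgebra k M) Y]
  [IsScalarTower k (MonoidAlgebra k M) Y]

/-- The zeros of the sandwich matrix are harmless: `λ_b ρ_a ∈ eMe`, and at an apex an element of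
`eMe` outside `G_e` annihilates `Y`. -/
lemma IsApex.asAlgebraHom_sandwichMatrix [Finite M] {e : Idem M} (h : IsApex k Y e)
    (s : SandwichReps e) (b : LClasses (e : M)) (a : RClasses (e : M))
    (w : corner k Y (e : M)) :
    ((cornerRep k Y e).asAlgebraHom (sandwichMatrix k s b a) w : Y) =
      act k (s.lam b) (act k (s.rho a) (w : Y)) := by
  rw [← act_mul]
  by_cases hg : ∃ g : MaxSubgroup e, g.val = s.lam b * s.rho a
  · obtain ⟨g, hg⟩ := hg
    rw [sandwichMatrix_apply_of_eq s hg, Representation.asAlgebraHom_single, one_smul, ← hg]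
    rfl
  · rw [sandwichMatrix_apply_of_not s hg, map_zero]
    by_contra hne
    have h1 : (e : M) * (s.lam b * s.rho a) = s.lam b * s.rho a := by
      rw [← mul_assoc, (isBiset_RClass e).e_mul (s.lam_mem b).1]
    have h2 := h.mul_mem_RClass k (m := s.lam b * s.rho a) (y := (w : Y))
      (by rw [h1]; exact fun h => hne (by rw [h]; rfl))
    rw [h1] at h2
    exact hg (RClass.exists_unit h2 (by rw [mul_assoc, LClass.mul_e (s.rho_mem a).1]))

-- For `0 ≠ w ∈ eY`, the vectors `(fme)w` span `fY`. If nonzero, `fme ∈ L_e` by the apex property.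
-- Then either `fme ∉ R̃_f`, a contribution to `below`, or `fme` is regular in `R̃_f`, hence in `R_f
-- ∩ L_e`.
open Classical in
lemma IsApex.corner_le [Finite M] [IsSimpleModule (MonoidAlgebra k M) Y] {e : Idem M}
    (h : IsApex k Y e) (f : Idem M) {x₀ : M}
    (hx₀ : (∃ x, x ∈ RClass (f : M) ∧ x ∈ LClass (e : M)) →
      x₀ ∈ RClass (f : M) ∧ x₀ ∈ LClass (e : M)) :
    corner k Y (f : M) ≤ below k Y (f : M) ⊔
      if (∃ x, x ∈ RClass (f : M) ∧ x ∈ LClass (e : M)) then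
        (corner k Y (e : M)).map (act k x₀) else ⊥ := by
  have := h.nontrivial
  obtain ⟨w, hw0⟩ := _root_.exists_ne (0 : corner k Y (e : M))
  have hw1 : (w : Y) ≠ 0 := fun h => hw0 (Subtype.ext h)
  have hwe := (mem_corner_iff k).1 w.2
  rintro _ ⟨z, rfl⟩
  refine Submodule.span_induction ?_ ?_ ?_ ?_ (mem_span_act_of_isSimple (M := M) k hw1 z)
  · rintro _ ⟨m, rfl⟩
    dsimp only
    have h1 : act k (f : M) (act k m (w : Y)) = act k (f * m * e) (w : Y) := by
      rw [act_mul, act_mul, hwe]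
    rw [h1]
    by_cases h0 : act k ((f : M) * m * e) (w : Y) = 0
    · rw [h0]; exact Submodule.zero_mem _
    have h2 := h.mul_mem_LClass k h0
    have h3 : (f : M) * (f * m * e) = f * m * e := by rw [← mul_assoc, ← mul_assoc, f.2]
    by_cases h4 : (f : M) * m * e ∈ RTildeClass (f : M)
    · have h5 := RTildeClass.mem_RClass h4 h2
      have hex : ∃ x, x ∈ RClass (f : M) ∧ x ∈ LClass (e : M) := ⟨_, h5, h2⟩
      rw [if_pos hex]
      -- Both `fme` and `x₀` lie in `R_f ∩ L_e`, so they differ by right multiplication by an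
      -- element of `G_e`, which preserves `eY`.
      obtain ⟨⟨u, hu⟩, -⟩ := rRel_iff.1 (show RRel _ _ from h5)
      obtain ⟨-, u', hu'⟩ := rRel_iff.1 (show RRel _ _ from (hx₀ hex).1)
      obtain ⟨g, hg⟩ := LClass.exists_eq_mul (hx₀ hex).2 h2 (u := u' * u)
        (by rw [← mul_assoc, hu', hu])
      rw [hg, act_mul]
      exact Submodule.mem_sup_right ⟨_, (cornerRep k Y e g w).2, rfl⟩
    · exact Submodule.mem_sup_left (act_mem_below k h3 h4 _)
  · rw [map_zero]; exact Submodule.zero_mem _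
  · intro x y _ _ hx hy; rw [map_add]; exact Submodule.add_mem _ hx hy
  · intro c x _ hx; rw [map_smul]; exact Submodule.smul_mem _ c hx

-- At the apex `e_j`, only those `q` with `R_{e_q} ∩ L_{e_j}` nonempty contribute beyond `below`,
-- each by at most `dim e_jS`. There are at most as many such `q` as `𝓡`-classes in `J_{e_j}`, and
-- left invertibility bounds that number times `dim e_jS` by `dim S`.
open Classical in
lemma simpleBound_of_isLeftInvertible [Finite M] {n : ℕ} (e : Fin n → Idem M)
    (he : ∀ f : Idem M, ∃! i, JRel (f : M) (e i : M))
    (hP : ∀ (i : Fin n) (s : SandwichReps (e i)), IsLeftInvertible (sandwichMatrix k s))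
    {ι : Type*} [Fintype ι] (R : RTildeReps M ι) : SimpleBound.{u, v, w} k R := by
  intro S _ _ _ _ _ hS
  obtain ⟨j, hj⟩ := exists_isApex (M := M) k (Y := S) e he
  obtain ⟨s⟩ : Nonempty (SandwichReps (e j)) := inferInstance
  let := Fintype.ofFinite (RClasses (e j : M))
  let W := corner k S (e j : M)
  -- Applying each `λ_b` to `Θ w = Σ ρ_a w_a` yields the sandwich matrix applied to `w`, so its left
  -- inverse makes `Θ` injective.
  let Θ : (RClasses (e j : M) → W) →ₗ[k] S :=
    ∑ a, (act k (s.rho a)) ∘ₗ W.subtype ∘ₗ LinearMap.proj a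
  have hΘ : ∀ w, Θ w = ∑ a, act k (s.rho a) (w a : S) := fun w => by
    simp [Θ]
  have hinj : Function.Injective Θ := by
    rw [injective_iff_map_eq_zero]
    intro w hw
    refine (hP j s).eq_zero
      (cornerRep k S (e j)).asAlgebraHom.toRingHom w fun b => ?_
    refine Subtype.ext ?_
    have h1 : act k (s.lam b) (Θ w) = 0 := by rw [hw, map_zero]
    rw [hΘ, map_sum] at h1
    rw [AddSubmonoidClass.coe_finsetSum, Submodule.coe_zero, ← h1]
    exact Finset.sum_congr rfl fun a _ => hj.asAlgebraHom_sandwichMatrix s b a (w a)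
  have hcard := LinearMap.finrank_le_finrank_of_injective hinj
  rw [Module.finrank_pi_fintype, Finset.sum_const, smul_eq_mul, Finset.card_univ] at hcard
  let Q : ι → Prop := fun q => ∃ x, x ∈ RClass (R.rep q : M) ∧ x ∈ LClass (e j : M)
  have hx : ∀ q, ∃ x₀, Q q → x₀ ∈ RClass (R.rep q : M) ∧ x₀ ∈ LClass (e j : M) := fun q => by
    by_cases hq : Q q
    · exact ⟨hq.choose, fun _ => hq.choose_spec⟩
    -- The value `1` is a dummy; `x₀ q` matters only when `Q q` holds.
    · exact ⟨1, fun h => absurd h hq⟩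
  choose x₀ hx₀ using hx
  have hb : ∀ q, Module.finrank k (corner k S (R.rep q : M)) ≤
      Module.finrank k (below k S (R.rep q : M)) + if Q q then Module.finrank k W else 0 := by
    intro q
    refine (Submodule.finrank_mono (hj.corner_le (R.rep q) (hx₀ q))).trans
      ((Submodule.finrank_add_le_finrank_add_finrank _ _).trans (Nat.add_le_add_left ?_ _))
    by_cases hq : Q q
    · rw [if_pos hq, if_pos hq]
      exact Submodule.finrank_map_le _ _
    · rw [if_neg hq, if_neg hq, finrank_bot]
  have hQ : (Finset.univ.filter Q).card ≤ Fintype.card (RClasses (e j : M)) := by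
    rw [← Fintype.card_subtype]
    refine Fintype.card_le_of_injective (fun q : {q // Q q} => (⟨RClass (R.rep q.1 : M), by
      obtain ⟨x, hx, hx'⟩ := q.2
      exact ⟨_, jRel_iff.2 ((jRel_iff.1 (jRel_of_mem hx hx')).symm), rfl⟩⟩ :
      RClasses (e j : M))) fun q q' hqq => ?_
    refine Subtype.ext (R.inj _ _ (RClass.mem_RTildeClass ?_))
    rw [← Subtype.mk.inj hqq]
    exact self_mem_RClass _
  refine (Finset.sum_le_sum fun q _ => hb q).trans ?_
  rw [Finset.sum_add_distrib, ← Finset.sum_filter, Finset.sum_const, smul_eq_mul, add_comm]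
  gcongr
  exact (Nat.mul_le_mul_right _ hQ).trans hcard

end Sandwich

/-! ### Injectivity of `Hom_G(R̃_e, V)` -/

section Injective

variable {k : Type u} [Field k] {M : Type v} [Monoid M]

/-- `R̃`-related idempotents fix each other on the left, hence are `𝓡`-related; this carries
`SimpleBound.inf_le` from representatives to all idempotents. -/
lemma below_inf_le [Finite M] {ι : Type*} [Fintype ι] {R : RTildeReps M ι} (H : SimpleBound.{u, v, w} k R)
    {Y : Type w} [AddCommGroup Y] [Module k Y] [Module (MonoidAlgebra k M) Y]
    [IsScalarTower k (MonoidAlgebra k M) Y] [Module.Finite k Y]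
    (N : Submodule (MonoidAlgebra k M) Y) (e : Idem M) (y : N)
    (hy : (y : Y) ∈ below k Y (e : M)) : y ∈ below k N (e : M) := by
  obtain ⟨q, hq⟩ := R.exists_mem (e : M)
  have hR : RRel (e : M) (R.rep q : M) := rRel_iff.2
    ⟨⟨e, (hq _ (R.rep q).2).2 (R.rep q).2⟩, ⟨R.rep q, (hq _ e.2).1 e.2⟩⟩
  rw [below_congr k hR e.2 (R.rep q).2] at hy ⊢
  obtain ⟨y', hy', hyy⟩ := (H.inf_le N q).le ⟨hy, y.2⟩
  rwa [← show y' = y from Subtype.ext hyy]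

variable {e : Idem M} {V : Type w} [AddCommGroup V] [Module k V]
  (ρ : Representation k (MaxSubgroup e) V)

/-- An element of `Hom_G(X, V)` from an equivariant map. -/
def HomG.mk {X : Set M} {hX : IsBiset e X} {ρ : Representation k (MaxSubgroup e) V} (F : X → V)
    (hF : ∀ (g : MaxSubgroup e) (x : X), F ⟨g.val * x, hX.G_mul g x.2⟩ = ρ g (F x)) :
    HomG hX ρ := ⟨F, hF⟩

lemma HomG.ext {X : Set M} {hX : IsBiset e X} {ρ : Representation k (MaxSubgroup e) V}
    {F F' : HomG hX ρ} (h : ∀ x, F.1 x = F'.1 x) : F = F' := Subtype.ext (funext h)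

variable (e) in
lemma self_mem_RTildeClass : (e : M) ∈ RTildeClass (e : M) := fun _ _ => Iff.rfl

variable [Finite M] [IsLeftFountain M]

/-- Maps into `Hom_G(R̃_e, V)` from linear maps killing the action of `eM \ R̃_e`. -/
def homOfLinear {Y : Type*} [AddCommGroup Y] [Module k Y] [Module (MonoidAlgebra k M) Y]
    [IsScalarTower k (MonoidAlgebra k M) Y] (Γ : Y →ₗ[k] V)
    (hG : ∀ (g : MaxSubgroup e) (y : Y), Γ (act k g.val y) = ρ g (Γ y))
    (hΓ : ∀ y ∈ below k Y (e : M), Γ y = 0) : Y →ₗ[MonoidAlgebra k M] (HomRTilde ρ).asModule :=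
  linearMapOfAct k (Z := (HomRTilde ρ).asModule)
    (show Y →ₗ[k] HomG (isBiset_RTildeClass e) ρ from
    { toFun := fun y => HomG.mk (fun x => Γ (act k (x : M) y)) fun g x => by rw [act_mul, hG]
      map_add' := fun y y' => HomG.ext fun x => by
        change Γ _ = Γ _ + Γ _
        rw [map_add, map_add]
      map_smul' := fun c y => HomG.ext fun x => by
        change Γ _ = c • Γ _
        rw [map_smul, map_smul] })
    (fun m y => by
      rw [act_asModule]
      refine HomG.ext (hX := isBiset_RTildeClass e) (ρ := ρ) fun x => ?_
      change Γ (act k (x : M) (act k m y)) = (homAct m _).1 x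
      rw [← act_mul]
      by_cases hx : (x : M) * m ∈ RTildeClass (e : M)
      · rw [homAct_of_mem _ hx]; rfl
      · rw [homAct_of_notMem _ hx]
        exact hΓ _ (act_mem_below k
          (by rw [← mul_assoc, (isBiset_RTildeClass e).e_mul x.2]) hx y))

lemma homOfLinear_apply {Y : Type*} [AddCommGroup Y] [Module k Y] [Module (MonoidAlgebra k M) Y]
    [IsScalarTower k (MonoidAlgebra k M) Y] (Γ : Y →ₗ[k] V) (hG) (hΓ) (y : Y)
    (x : RTildeClass (e : M)) :
    ((HomRTilde ρ).asModuleEquiv (homOfLinear ρ Γ hG hΓ y)).1 x = Γ (act k (x : M) y) := rfl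

/-- Evaluation of elements of `Hom_G(R̃_e, V)` at `e`. -/
def evalIdem : (HomRTilde ρ).asModule →ₗ[k] V where
  toFun F := ((HomRTilde ρ).asModuleEquiv F).1 ⟨e, self_mem_RTildeClass e⟩
  map_add' _ _ := rfl
  map_smul' _ _ := rfl

lemma evalIdem_act_of_mem (F : (HomRTilde ρ).asModule) (x : RTildeClass (e : M)) :
    evalIdem ρ (act k (x : M) F) = ((HomRTilde ρ).asModuleEquiv F).1 x := by
  rw [act_asModule]
  have h : (e : M) * x = x := (isBiset_RTildeClass e).e_mul x.2
  refine (homAct_of_mem _ (by rw [h]; exact x.2)).trans ?_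
  exact congrArg _ (Subtype.ext h)

lemma evalIdem_act_of_notMem (F : (HomRTilde ρ).asModule) {m : M} (h1 : (e : M) * m = m)
    (hm : m ∉ RTildeClass (e : M)) : evalIdem ρ (act k m F) = 0 := by
  rw [act_asModule]
  exact homAct_of_notMem _ (by rwa [h1])

lemma evalIdem_act_unit (F : (HomRTilde ρ).asModule) (g : MaxSubgroup e) :
    evalIdem ρ (act k g.val F) = ρ g (evalIdem ρ F) := by
  have hg : g.val ∈ RTildeClass (e : M) := RClass.mem_RTildeClass g.mem_RClass
  rw [evalIdem_act_of_mem ρ F ⟨g.val, hg⟩]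
  refine Eq.trans ?_ (((HomRTilde ρ).asModuleEquiv F).2 g ⟨e, self_mem_RTildeClass e⟩)
  exact congrArg _ (Subtype.ext g.mul_e.symm)

/-- Baer's criterion. Evaluation at `e` turns a map on a left ideal `I` into a functional `γ`
killing `below I = below (kM) ∩ I`. So `γ` extends to `kM` with `below (kM)` killed, and averaging
over `G_e`, whose order is invertible in `k`, restores equivariance without disturbing the values on
`I`. -/
theorem injective_HomRTilde (hchar : ¬ ringChar k ∣ Nat.card (MaxSubgroup e))
    {ι : Type*} [Fintype ι] {R : RTildeReps M ι} (H : SimpleBound.{u, v, max u v} k R) :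
    Module.Injective (MonoidAlgebra k M) (HomRTilde ρ).asModule := by
  refine Module.Baer.injective fun I g => ?_
  let := Fintype.ofFinite (MaxSubgroup e)
  have hG0 : (Fintype.card (MaxSubgroup e) : k) ≠ 0 := fun h => by
    rw [← Nat.card_eq_fintype_card] at h
    exact hchar (ringChar.dvd h)
  let γ : I →ₗ[k] V := evalIdem ρ ∘ₗ g.restrictScalars k
  have hγ : ∀ x, γ x = evalIdem ρ (g x) := fun _ => rfl
  have hγ0 : ∀ y ∈ below k I (e : M), γ y = 0 := by
    intro y hy
    refine Submodule.span_induction ?_ (map_zero _) ?_ ?_ hy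
    · rintro _ ⟨m, y, h1, h2, rfl⟩
      rw [hγ, map_act]
      exact evalIdem_act_of_notMem ρ _ h1 h2
    · intro x y _ _ hx hy; rw [map_add, hx, hy, add_zero]
    · intro c x _ hx; rw [map_smul, hx, smul_zero]
  obtain ⟨Γ₀, hΓ₁, hΓ₂⟩ := exists_extend_of_inf_le_ker (I.restrictScalars k)
    (below k (MonoidAlgebra k M) (e : M)) γ (fun x hx => hγ0 _ (below_inf_le H I e x hx))
  let Γ : MonoidAlgebra k M →ₗ[k] V := (Fintype.card (MaxSubgroup e) : k)⁻¹ •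
    ∑ g : MaxSubgroup e, ρ g⁻¹ ∘ₗ Γ₀ ∘ₗ act k g.val
  have hΓ : ∀ y, Γ y = (Fintype.card (MaxSubgroup e) : k)⁻¹ •
      ∑ g : MaxSubgroup e, ρ g⁻¹ (Γ₀ (act k g.val y)) := fun y => by
    simp [Γ, LinearMap.sum_apply]
  have hΓG : ∀ (g : MaxSubgroup e) (y), Γ (act k g.val y) = ρ g (Γ y) := by
    intro h y
    rw [hΓ, hΓ, map_smul, map_sum]
    congr 1
    refine Fintype.sum_equiv (Equiv.mulRight h) _ _ fun g => ?_
    have h1 : ∀ v, ρ g⁻¹ v = ρ h (ρ (g * h)⁻¹ v) := fun v => by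
      rw [← Module.End.mul_apply, ← map_mul, mul_inv_rev, mul_inv_cancel_left]
    rw [Equiv.coe_mulRight, MaxSubgroup.val_mul, act_mul, h1]
  have hΓB : ∀ y ∈ below k (MonoidAlgebra k M) (e : M), Γ y = 0 := by
    intro y hy
    refine Submodule.span_induction ?_ (map_zero _) ?_ ?_ hy
    · rintro _ ⟨m, y, h1, h2, rfl⟩
      rw [hΓ, Finset.sum_eq_zero, smul_zero]
      intro h _
      rw [← act_mul, hΓ₂, map_zero]
      -- Averaging keeps the vanishing because `G_e` preserves `eM \ R̃_e`.
      refine act_mem_below k (by rw [← mul_assoc, h.e_mul]) (fun h3 => h2 ?_) y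
      have := (isBiset_RTildeClass e).G_mul h⁻¹ h3
      rwa [← mul_assoc, h.inv_mul_val, h1] at this
    · intro x y _ _ hx hy; rw [map_add, hx, hy, add_zero]
    · intro c x _ hx; rw [map_smul, hx, smul_zero]
  have hΓI : ∀ x : I, Γ x = γ x := by
    intro x
    rw [hΓ, Finset.sum_congr rfl (g := fun _ => γ x), Finset.sum_const, Finset.card_univ,
      ← Nat.cast_smul_eq_nsmul k, smul_smul, inv_mul_cancel₀ hG0, one_smul]
    intro h _
    have h1 : Γ₀ (act k h.val (x : MonoidAlgebra k M)) = γ (act k h.val x) := hΓ₁ (act k h.val x)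
    rw [h1, hγ, map_act, evalIdem_act_unit, ← Module.End.mul_apply, ← map_mul,
      inv_mul_cancel, map_one, Module.End.one_apply, hγ]
  refine ⟨homOfLinear ρ Γ hΓG hΓB, fun x hx => ?_⟩
  refine HomG.ext (hX := isBiset_RTildeClass e) (ρ := ρ) fun y => ?_
  refine (homOfLinear_apply ρ Γ hΓG hΓB x y).trans ?_
  have h1 := hΓI (act k (y : M) ⟨x, hx⟩)
  rw [coe_act, hγ, map_act] at h1
  exact h1.trans (evalIdem_act_of_mem ρ _ y)

end Injective

/-! ### `Hom_G(R̃_e, V)` is an essential extension of the socle of the coinduced module -/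

section Essential

variable {k : Type u} [Field k] {M : Type v} [Monoid M]

lemma isIrreducible_toRepresentation {Y : Type*} [AddCommGroup Y] [Module k Y]
    {σ : Representation k M Y} (T : Subrepresentation σ) (hne : ∃ w ∈ T.toSubmodule, w ≠ 0)
    (hT : ∀ w ∈ T.toSubmodule, w ≠ 0 → ∀ z ∈ T.toSubmodule,
      z ∈ Submodule.span k (Set.range fun m : M => σ m w)) : T.toRepresentation.IsIrreducible := by
  obtain ⟨w₀, hw₀, hne⟩ := hne
  have : Nontrivial T.toSubmodule :=
    nontrivial_of_ne ⟨w₀, hw₀⟩ 0 fun h => hne (congrArg Subtype.val h)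
  refine isIrreducible_of k _ fun N w hw hw0 => ?_
  rw [eq_top_iff]
  rintro z -
  have h1 : Submodule.span k (Set.range fun m : M => σ m (w : Y)) ≤
      N.toSubmodule.map T.toSubmodule.subtype := by
    rw [Submodule.span_le]
    rintro _ ⟨m, rfl⟩
    exact ⟨_, N.apply_mem_toSubmodule m hw, rfl⟩
  obtain ⟨z', hz', hzz⟩ := h1 (hT w w.2 (fun h => hw0 (Subtype.ext h)) z z.2)
  rwa [← show z' = z from Subtype.ext hzz]

lemma mem_span_act_of_isSimple_submodule {Y : Type*} [AddCommGroup Y] [Module k Y]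
    [Module (MonoidAlgebra k M) Y] [IsScalarTower k (MonoidAlgebra k M) Y]
    (S : Submodule (MonoidAlgebra k M) Y) [IsSimpleModule (MonoidAlgebra k M) S] {y z : Y}
    (hy : y ∈ S) (hy0 : y ≠ 0) (hz : z ∈ S) :
    z ∈ Submodule.span k (Set.range fun m : M => act k m y) := by
  obtain ⟨a, ha⟩ := IsSimpleModule.toSpanSingleton_surjective (MonoidAlgebra k M)
    (m := (⟨y, hy⟩ : S)) (fun h => hy0 (congrArg Subtype.val h)) ⟨z, hz⟩
  rw [← show a • y = z from congrArg Subtype.val ha]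
  exact mem_span_act k y a

variable {e : Idem M} {V : Type w} [AddCommGroup V] [Module k V]
  (ρ : Representation k (MaxSubgroup e) V)

open Classical in
/-- The extension by zero of an equivariant map from `R_e` to `R̃_e`. -/
def extFun (F : HomG (isBiset_RClass e) ρ) (x : RTildeClass (e : M)) : V :=
  if h : (x : M) ∈ RClass (e : M) then F.1 ⟨x, h⟩ else 0

variable {ρ} in
lemma extFun_of_mem (F : HomG (isBiset_RClass e) ρ) {x : RTildeClass (e : M)}
    (h : (x : M) ∈ RClass (e : M)) : extFun ρ F x = F.1 ⟨x, h⟩ := dif_pos h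

variable {ρ} in
lemma extFun_of_notMem (F : HomG (isBiset_RClass e) ρ) {x : RTildeClass (e : M)}
    (h : (x : M) ∉ RClass (e : M)) : extFun ρ F x = 0 := dif_neg h

variable [Finite M] [IsLeftFountain M]

/-- `F(x)` is the value at `e` of `xF = (xf)F`. If it is nonzero, `xf` lies in `L_f` and in `R̃_e`,
and being regular it lies in `R_e`. -/
lemma mem_of_apply_ne_zero {f : Idem M} (F : (HomRTilde ρ).asModule)
    (hF : act k (f : M) F = F) (hL : ∀ m : M, act k (m * f) F ≠ 0 → m * f ∈ LClass (f : M))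
    {x : RTildeClass (e : M)} (hx : ((HomRTilde ρ).asModuleEquiv F).1 x ≠ 0) :
    (x : M) * f ∈ RClass (e : M) ∧ (x : M) * f ∈ LClass (f : M) := by
  rw [← evalIdem_act_of_mem, ← hF, ← act_mul] at hx
  have h1 : (x : M) * f ∈ LClass (f : M) := hL _ fun h => hx (by rw [h, map_zero])
  have h2 : (x : M) * f ∈ RTildeClass (e : M) := by
    by_contra h
    exact hx (evalIdem_act_of_notMem ρ F
      (by rw [← mul_assoc, (isBiset_RTildeClass e).e_mul x.2]) h)
  exact ⟨RTildeClass.mem_RClass h2 h1, h1⟩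

/-- The inclusion of the coinduced module into `Hom_G(R̃_e, V)`, as a linear map. -/
def extLinear : HomG (isBiset_RClass e) ρ →ₗ[k] HomG (isBiset_RTildeClass e) ρ where
  toFun F := HomG.mk (extFun ρ F) fun g x => by
    by_cases h : (x : M) ∈ RClass (e : M)
    · rw [extFun_of_mem F h,
        extFun_of_mem F (x := ⟨g.val * x, _⟩) ((isBiset_RClass e).G_mul g h)]
      exact F.2 g ⟨x, h⟩
    · rw [extFun_of_notMem F h, extFun_of_notMem, map_zero]
      intro h'
      have := (isBiset_RClass e).G_mul g⁻¹ h'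
      rw [← mul_assoc, g.inv_mul_val, (isBiset_RTildeClass e).e_mul x.2] at this
      exact h this
  map_add' F F' := HomG.ext fun x => by
    change extFun ρ _ x = extFun ρ _ x + extFun ρ _ x
    by_cases h : (x : M) ∈ RClass (e : M)
    · simp only [extFun_of_mem _ h]; rfl
    · simp only [extFun_of_notMem _ h, add_zero]
  map_smul' c F := HomG.ext fun x => by
    change extFun ρ _ x = c • extFun ρ _ x
    by_cases h : (x : M) ∈ RClass (e : M)
    · simp only [extFun_of_mem _ h]; rfl
    · simp only [extFun_of_notMem _ h, smul_zero]

/-- For `x ∈ eM`, `xm ∈ R_e` implies `x ∈ R_e`, so right multiplication never moves `R̃_e \ R_e`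
into `R_e`. -/
lemma extLinear_act (m : M) (F : HomG (isBiset_RClass e) ρ) :
    extLinear ρ (homAct m F) = homAct m (extLinear ρ F) := by
  refine HomG.ext fun x => ?_
  change extFun ρ _ x = _
  have hR : (x : M) * m ∈ RClass (e : M) → (x : M) ∈ RClass (e : M) := fun h => by
    obtain ⟨-, z, hz⟩ := rRel_iff.1 (show RRel _ _ from h)
    exact rRel_iff.2 ⟨⟨x, (isBiset_RTildeClass e).e_mul x.2⟩, ⟨m * z, by rw [← mul_assoc, hz]⟩⟩
  by_cases h1 : (x : M) * m ∈ RClass (e : M)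
  · rw [extFun_of_mem _ (hR h1), homAct_of_mem (X := RClass (e : M)) F (x := ⟨x, hR h1⟩) h1,
      homAct_of_mem _ (RClass.mem_RTildeClass h1)]
    exact (extFun_of_mem F (x := ⟨x * m, _⟩) h1).symm
  · have h2 : extFun ρ (homAct m F) x = 0 := by
      by_cases h : (x : M) ∈ RClass (e : M)
      · rw [extFun_of_mem _ h, homAct_of_notMem (X := RClass (e : M)) F (x := ⟨x, h⟩) h1]
      · exact extFun_of_notMem _ h
    rw [h2]
    by_cases h3 : (x : M) * m ∈ RTildeClass (e : M)
    · rw [homAct_of_mem _ h3]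
      exact (extFun_of_notMem F (x := ⟨x * m, h3⟩) h1).symm
    · rw [homAct_of_notMem _ h3]

lemma extLinear_injective : Function.Injective (extLinear ρ) := by
  intro F F' h
  refine HomG.ext fun x => ?_
  have h1 := congrFun (congrArg Subtype.val h) ⟨x, RClass.mem_RTildeClass x.2⟩
  exact (extFun_of_mem F x.2).symm.trans (h1.trans (extFun_of_mem F' x.2))

lemma mem_range_extLinear (F : HomG (isBiset_RTildeClass e) ρ)
    (hF : ∀ x : RTildeClass (e : M), F.1 x ≠ 0 → (x : M) ∈ RClass (e : M)) :
    ∃ F₀, extLinear ρ F₀ = F := by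
  refine ⟨HomG.mk (fun x => F.1 ⟨x, RClass.mem_RTildeClass x.2⟩) fun g x =>
    F.2 g ⟨x, RClass.mem_RTildeClass x.2⟩, ?_⟩
  refine HomG.ext fun x => ?_
  change extFun ρ _ x = _
  by_cases h : (x : M) ∈ RClass (e : M)
  · exact extFun_of_mem _ h
  · rw [extFun_of_notMem _ h]
    by_contra h'
    exact h (hF x (Ne.symm h'))

/-- The inclusion of the socle of the coinduced module into `Hom_G(R̃_e, V)`. -/
def sharpInclusion : (Sharp ρ).asModule →ₗ[MonoidAlgebra k M] (HomRTilde ρ).asModule :=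
  linearMapOfAct k (Y := (Sharp ρ).asModule) (Z := (HomRTilde ρ).asModule)
    (extLinear ρ ∘ₗ (socle (Coind ρ)).toSubmodule.subtype) fun m F => by
      rw [act_asModule, act_asModule]
      exact extLinear_act ρ m _

lemma sharpInclusion_injective : Function.Injective (sharpInclusion ρ) :=
  (extLinear_injective ρ).comp Subtype.val_injective

/-- Let `S` be simple in `N` with apex `e_j`, and `0 ≠ F ∈ e_jS`. By `mem_of_apply_ne_zero`, a
nonzero value of `F` forces `j = i` and then support in `R_{e_i}`. So `F` comes from the coinduced
module, where the preimage of `S` is irreducible. -/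
theorem sharpInclusion_essential {n : ℕ} (e : Fin n → Idem M)
    (he : ∀ f : Idem M, ∃! i, JRel (f : M) (e i : M)) (i : Fin n)
    (ρ : Representation k (MaxSubgroup (e i)) V)
    (N : Submodule (MonoidAlgebra k M) (HomRTilde ρ).asModule)
    (hN : N ⊓ LinearMap.range (sharpInclusion ρ) = ⊥) : N = ⊥ := by
  by_contra hne
  obtain ⟨S, hSN, hS⟩ := exists_isSimpleModule_le hne
  obtain ⟨j, hj⟩ := exists_isApex k (Y := S) e he
  obtain ⟨s, hs⟩ := hj.exists_ne
  let F : (HomRTilde ρ).asModule := (act k (e j : M) s : S)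
  have hFS : F ∈ S := (act k (e j : M) s).2
  have hF0 : F ≠ 0 := fun h => hs (Subtype.ext h)
  have hFe : act k (e j : M) F = F := by
    change act k (e j : M) (act k (e j : M) (s : (HomRTilde ρ).asModule)) = _
    rw [← act_mul, (e j).2]
    rfl
  have hFL : ∀ m : M, act k (m * e j) F ≠ 0 → m * e j ∈ LClass (e j : M) := fun m hm =>
    hj.mul_mem_LClass k (y := act k (e j : M) s) fun h => hm (congrArg Subtype.val h)
  have hval : ∃ x, ((HomRTilde ρ).asModuleEquiv F).1 x ≠ 0 := by
    by_contra! h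
    exact hF0 (HomG.ext (hX := isBiset_RTildeClass (e i)) (ρ := ρ) h)
  obtain ⟨x, hx⟩ := hval
  obtain ⟨h1, h2⟩ := mem_of_apply_ne_zero ρ F hFe hFL hx
  have hij : i = j := by
    obtain ⟨l, -, hl⟩ := he (e j)
    rw [hl i (jRel_of_mem h1 h2), hl j rfl]
  subst hij
  obtain ⟨F₀, hF₀⟩ := mem_range_extLinear ρ F fun y hy => by
    obtain ⟨-, z, hz⟩ := rRel_iff.1 (show RRel _ _ from (mem_of_apply_ne_zero ρ F hFe hFL hy).1)
    exact rRel_iff.2 ⟨⟨y, (isBiset_RTildeClass (e i)).e_mul y.2⟩, ⟨e i * z, by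
      rw [← mul_assoc, hz]⟩⟩
  -- `T` is irreducible because `extLinear` is injective and carries orbits to orbits, so the span
  -- of any nonzero orbit in `T` contains `T`.
  let T : Subrepresentation (Coind ρ) :=
    { toSubmodule := (S.restrictScalars k).comap (extLinear ρ)
      apply_mem_toSubmodule := fun m F hF => by
        have h : act k m (show (HomRTilde ρ).asModule from extLinear ρ F) ∈ S := act_mem k S m hF
        rw [act_asModule] at h
        change extLinear ρ (homAct m F) ∈ S
        rw [extLinear_act]
        exact h }
  have hT : T.toRepresentation.IsIrreducible := by
    refine isIrreducible_toRepresentation T ⟨F₀, ?_, fun h => hF0 ?_⟩ fun w hw hw0 z hz => ?_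
    · change extLinear ρ F₀ ∈ S
      rw [hF₀]; exact hFS
    · rw [← hF₀, h]; exact map_zero _
    · have h3 := mem_span_act_of_isSimple_submodule S (y := extLinear ρ w) (z := extLinear ρ z) hw
        (fun h => hw0 (extLinear_injective ρ (h.trans (map_zero _).symm))) hz
      have h4 : (extLinear ρ ∘ fun m => Coind ρ m w) =
          fun m => act k m (show (HomRTilde ρ).asModule from extLinear ρ w) := funext fun m => by
        rw [act_asModule]
        exact extLinear_act ρ m w
      have h5 : extLinear ρ z ∈
          Submodule.span k (Set.range (extLinear ρ ∘ fun m => Coind ρ m w)) := by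
        rw [h4]; exact h3
      rw [Set.range_comp, ← Submodule.map_span] at h5
      obtain ⟨z', hz', hzz⟩ := h5
      rwa [← extLinear_injective ρ hzz]
  have hF₀T : F₀ ∈ T.toSubmodule := by
    change extLinear ρ F₀ ∈ S
    rw [hF₀]; exact hFS
  have hsoc : F₀ ∈ (socle (Coind ρ)).toSubmodule :=
    le_iSup₂_of_le (f := fun (S : Subrepresentation (Coind ρ))
      (_ : S.toRepresentation.IsIrreducible) => S.toSubmodule) T hT le_rfl hF₀T
  have hmem : F ∈ N ⊓ LinearMap.range (sharpInclusion ρ) := ⟨hSN hFS, ⟨⟨F₀, hsoc⟩, hF₀⟩⟩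
  rw [hN] at hmem
  exact hF0 hmem

end Essential

/-! ### Balanced tensor products -/

section Balanced

variable {k : Type u} [Field k] {G : Type*} [Monoid G] {X Y Z : Type*} [AddCommGroup X]
  [Module k X] [AddCommGroup Y] [Module k Y] [AddCommGroup Z] [Module k Z]
  (τ : Representation k Gᵐᵒᵖ X) (ρ : Representation k G Y)

/-- The canonical bilinear map to the tensor product over `kG`. -/
def balancedMk : X →ₗ[k] Y →ₗ[k] BalancedTensor τ ρ :=
  (TensorProduct.mk k X Y).compr₂ (balanced τ ρ).mkQ

lemma balancedMk_apply (x : X) (y : Y) :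
    balancedMk τ ρ x y = (balanced τ ρ).mkQ (x ⊗ₜ[k] y) := rfl

lemma balancedMk_act (x : X) (g : G) (y : Y) :
    balancedMk τ ρ (τ (MulOpposite.op g) x) y = balancedMk τ ρ x (ρ g y) := by
  rw [balancedMk_apply, balancedMk_apply, ← sub_eq_zero, ← map_sub, Submodule.mkQ_apply,
    Submodule.Quotient.mk_eq_zero]
  exact Submodule.subset_span ⟨x, g, y, rfl⟩

variable {τ ρ} in
lemma balanced_induction {p : BalancedTensor τ ρ → Prop} (h0 : p 0)
    (hadd : ∀ ξ η, p ξ → p η → p (ξ + η)) (h : ∀ x y, p (balancedMk τ ρ x y))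
    (ξ : BalancedTensor τ ρ) : p ξ := by
  obtain ⟨t, rfl⟩ := (balanced τ ρ).mkQ_surjective ξ
  induction t using TensorProduct.induction_on with
  | zero => rwa [map_zero]
  | add s t hs ht => rw [map_add]; exact hadd _ _ hs ht
  | tmul x y => exact h x y

/-- The linear map on the tensor product over `kG` given by a balanced bilinear map. -/
def balancedLift (B : X →ₗ[k] Y →ₗ[k] Z)
    (hB : ∀ x g y, B (τ (MulOpposite.op g) x) y = B x (ρ g y)) : BalancedTensor τ ρ →ₗ[k] Z :=
  (balanced τ ρ).liftQ (TensorProduct.lift B) <| by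
    refine Submodule.span_le.2 ?_
    rintro _ ⟨x, g, y, rfl⟩
    rw [SetLike.mem_coe, LinearMap.mem_ker, map_sub, TensorProduct.lift.tmul,
      TensorProduct.lift.tmul, hB, sub_self]

lemma balancedLift_mk (B : X →ₗ[k] Y →ₗ[k] Z) (hB) (x : X) (y : Y) :
    balancedLift τ ρ B hB (balancedMk τ ρ x y) = B x y := rfl

lemma tensorActLeft_mk {N : Type*} [Monoid N] (σ : Representation k N X)
    (h : ∀ n g x, σ n (τ g x) = τ g (σ n x)) (n : N) (x : X) (y : Y) :
    tensorActLeft τ ρ σ h n (balancedMk τ ρ x y) = balancedMk τ ρ (σ n x) y := rfl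

lemma tensorActRight_mk {N : Type*} [Monoid N] (σ : Representation k N Y)
    (h : ∀ n g y, σ n (ρ g y) = ρ g (σ n y)) (n : N) (x : X) (y : Y) :
    tensorActRight τ ρ σ h n (balancedMk τ ρ x y) = balancedMk τ ρ x (σ n y) := rfl

end Balanced

/-! ### Induced modules -/

section Ind

variable {k : Type u} [Field k] {M : Type v} [Monoid M] {e : Idem M}
  {V : Type w} [AddCommGroup V] [Module k V] (ρ : Representation k (MaxSubgroup e) V)

/-- The element `x ⊗ v` of the induced module. -/
def indTmul (x : LClass (e : M)) : V →ₗ[k] BalancedTensor (LRepG k e) ρ :=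
  balancedMk (LRepG k e) ρ (Finsupp.single x 1)

lemma LRepG_single (x : LClass (e : M)) (g : MaxSubgroup e) (c : k) :
    LRepG k e (MulOpposite.op g) (Finsupp.single x c) =
      Finsupp.single ⟨x * g.val, LClass.mul_G x.2 g⟩ c :=
  partialMap_single (f := fun x => x * g.val) (LClass.mul_G x.2 g) c

lemma indTmul_mul (x : LClass (e : M)) (g : MaxSubgroup e) (v : V) :
    indTmul ρ ⟨x * g.val, LClass.mul_G x.2 g⟩ v = indTmul ρ x (ρ g v) := by
  rw [indTmul, indTmul, ← balancedMk_act, LRepG_single]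

lemma Ind_indTmul (m : M) (x : LClass (e : M)) (v : V) (h : m * (x : M) ∈ LClass (e : M)) :
    Ind ρ m (indTmul ρ x v) = indTmul ρ ⟨m * x, h⟩ v := by
  rw [indTmul, Ind, tensorActLeft_mk, show LRep k e m (Finsupp.single x 1) =
    Finsupp.single ⟨m * x, h⟩ 1 from partialMap_single (f := fun x => m * x) h 1]
  rfl

lemma Ind_indTmul_of_notMem (m : M) (x : LClass (e : M)) (v : V)
    (h : m * (x : M) ∉ LClass (e : M)) : Ind ρ m (indTmul ρ x v) = 0 := by
  rw [indTmul, Ind, tensorActLeft_mk, show LRep k e m (Finsupp.single x 1) = 0 from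
    partialMap_single_of_notMem (f := fun x => m * x) h 1, map_zero, LinearMap.zero_apply]

variable {ρ} in
lemma Ind_induction {p : BalancedTensor (LRepG k e) ρ → Prop} (h0 : p 0)
    (hadd : ∀ ξ η, p ξ → p η → p (ξ + η)) (h : ∀ x v, p (indTmul ρ x v))
    (ξ : BalancedTensor (LRepG k e) ρ) : p ξ := by
  refine balanced_induction h0 hadd (fun X v => ?_) ξ
  induction X using Finsupp.induction_linear with
  | zero => rwa [map_zero, LinearMap.zero_apply]
  | add X Y hX hY => rw [map_add, LinearMap.add_apply]; exact hadd _ _ hX hY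
  | single x c =>
    have h1 : Finsupp.single x c = c • Finsupp.single x (1 : k) := by simp
    rw [h1, map_smul, LinearMap.smul_apply, ← map_smul]
    exact h x (c • v)

/-- The linear map on the induced module given by a family of linear maps on `V` compatible with
the right action of `G_e` on `L_e`. -/
def indLift {V' : Type*} [AddCommGroup V'] [Module k V'] (c : LClass (e : M) → V →ₗ[k] V')
    (hc : ∀ (x : LClass (e : M)) (g : MaxSubgroup e) (v : V),
      c ⟨x * g.val, LClass.mul_G x.2 g⟩ v = c x (ρ g v)) :
    BalancedTensor (LRepG k e) ρ →ₗ[k] V' :=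
  balancedLift (LRepG k e) ρ (Finsupp.linearCombination k c) fun X g v => by
    induction X using Finsupp.induction_linear with
    | zero => simp only [map_zero, LinearMap.zero_apply]
    | add X Y hX hY => simp only [map_add, LinearMap.add_apply, hX, hY]
    | single x a =>
      rw [LRepG_single, Finsupp.linearCombination_single, Finsupp.linearCombination_single,
        LinearMap.smul_apply, LinearMap.smul_apply, hc]

lemma indLift_indTmul {V' : Type*} [AddCommGroup V'] [Module k V']
    (c : LClass (e : M) → V →ₗ[k] V') (hc) (x : LClass (e : M)) (v : V) :
    indLift ρ c hc (indTmul ρ x v) = c x v := by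
  rw [indTmul, indLift, balancedLift_mk, Finsupp.linearCombination_single, one_smul]

/-! ### Functionals on the induced module. -/

open Classical in
/-- The action of the element `g ∈ G_e` related to `x`, or zero if there is none. -/
def relMap (E : MaxSubgroup e → M → Prop) (x : M) : V →ₗ[k] V :=
  if h : ∃ g, E g x then ρ h.choose else 0

variable {E : MaxSubgroup e → M → Prop}

lemma relMap_of (hu : ∀ g g' x, E g x → E g' x → g = g') {x : M} {g : MaxSubgroup e}
    (h : E g x) : relMap ρ E x = ρ g := by
  have hex : ∃ g, E g x := ⟨g, h⟩
  rw [relMap, dif_pos hex, hu _ _ _ hex.choose_spec h]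

lemma relMap_of_not {x : M} (h : ¬ ∃ g, E g x) : relMap ρ E x = 0 := dif_neg h

/-- The functional on the induced module given by `relMap`. -/
def relFunctional (E : MaxSubgroup e → M → Prop) (hu : ∀ g g' x, E g x → E g' x → g = g')
    (hm : ∀ g (x : LClass (e : M)) g', E g (x : M) → E (g * g') (x * g'.val)) :
    BalancedTensor (LRepG k e) ρ →ₗ[k] V :=
  indLift ρ (fun x => relMap ρ E x) fun x g' v => by
    by_cases h : ∃ g, E g (x : M)
    · obtain ⟨g, hg⟩ := h
      rw [relMap_of ρ hu hg, relMap_of ρ hu (hm g x g' hg), map_mul, Module.End.mul_apply]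
    · rw [relMap_of_not ρ h, relMap_of_not ρ]
      · rfl
      rintro ⟨g, hg⟩
      refine h ⟨g * g'⁻¹, ?_⟩
      have := hm g ⟨x * g'.val, LClass.mul_G x.2 g'⟩ g'⁻¹ hg
      rwa [mul_assoc, g'.mul_inv_val, LClass.mul_e x.2] at this

lemma relFunctional_indTmul (hu hm) (x : LClass (e : M)) (v : V) :
    relFunctional ρ E hu hm (indTmul ρ x v) = relMap ρ E x v := indLift_indTmul ρ _ _ x v

lemma val_eq_unique {y : M} (g g' : MaxSubgroup e) (x : M) (h : g.val = y * x)
    (h' : g'.val = y * x) : g = g' := MaxSubgroup.val_injective (h.trans h'.symm)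

/-- The component at `y` of the map from the induced to the coinduced module. -/
def toCoind (y : M) : BalancedTensor (LRepG k e) ρ →ₗ[k] V :=
  relFunctional ρ (fun g x => g.val = y * x) val_eq_unique
    fun g x g' h => by rw [MaxSubgroup.val_mul, h, mul_assoc]

lemma toCoind_of {y : M} {x : LClass (e : M)} {g : MaxSubgroup e} (h : g.val = y * x) (v : V) :
    toCoind ρ y (indTmul ρ x v) = ρ g v := by
  rw [toCoind, relFunctional_indTmul, relMap_of ρ val_eq_unique h]

lemma toCoind_of_not {y : M} {x : LClass (e : M)} (h : ¬ ∃ g : MaxSubgroup e, g.val = y * x)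
    (v : V) : toCoind ρ y (indTmul ρ x v) = 0 := by
  rw [toCoind, relFunctional_indTmul,
    relMap_of_not ρ (E := fun g x => g.val = y * x) h, LinearMap.zero_apply]

/-- The zero conventions on the two sides match: `ymx ∈ G_e` forces both `ym ∈ R_e` and `mx ∈ L_e`.
-/
lemma toCoind_Ind {y m : M} (hy : y ∈ RClass (e : M)) (ξ : BalancedTensor (LRepG k e) ρ) :
    (y * m ∈ RClass (e : M) → toCoind ρ y (Ind ρ m ξ) = toCoind ρ (y * m) ξ) ∧
    (y * m ∉ RClass (e : M) → toCoind ρ y (Ind ρ m ξ) = 0) := by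
  refine Ind_induction (p := fun ξ =>
    (y * m ∈ RClass (e : M) → toCoind ρ y (Ind ρ m ξ) = toCoind ρ (y * m) ξ) ∧
    (y * m ∉ RClass (e : M) → toCoind ρ y (Ind ρ m ξ) = 0))
    ?_ (fun ξ η hξ hη => ?_) (fun x v => ?_) ξ
  · simp only [map_zero, implies_true, and_self]
  · simp only [map_add]
    exact ⟨fun h => by rw [hξ.1 h, hη.1 h], fun h => by rw [hξ.2 h, hη.2 h, add_zero]⟩
  · by_cases hmx : m * (x : M) ∈ LClass (e : M)
    · rw [Ind_indTmul ρ m x v hmx]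
      by_cases hg : ∃ g : MaxSubgroup e, g.val = y * (m * x)
      · obtain ⟨g, hg⟩ := hg
        rw [toCoind_of ρ (x := ⟨m * x, hmx⟩) hg]
        refine ⟨fun _ => (toCoind_of ρ (by rw [hg, mul_assoc]) v).symm, fun h => absurd ?_ h⟩
        refine rRel_iff.2 ⟨⟨y * m, by rw [← mul_assoc, (isBiset_RClass e).e_mul hy]⟩,
          ⟨x * (g⁻¹).val, ?_⟩⟩
        rw [← mul_assoc, mul_assoc y, ← hg, g.mul_inv_val]
      · rw [toCoind_of_not ρ (x := ⟨m * x, hmx⟩) hg, toCoind_of_not ρ (by rwa [mul_assoc])]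
        exact ⟨fun _ => rfl, fun _ => rfl⟩
    · rw [Ind_indTmul_of_notMem ρ m x v hmx, map_zero, toCoind_of_not ρ]
      · exact ⟨fun _ => rfl, fun _ => rfl⟩
      rintro ⟨g, hg⟩
      refine hmx (lRel_iff.2 ⟨⟨m * x, by rw [mul_assoc, LClass.mul_e x.2]⟩,
        ⟨(g⁻¹).val * y, ?_⟩⟩)
      rw [mul_assoc, ← mul_assoc y, ← hg, g.inv_mul_val]

lemma toCoind_mul (g : MaxSubgroup e) {y : M} (hy : (e : M) * y = y)
    (ξ : BalancedTensor (LRepG k e) ρ) : toCoind ρ (g.val * y) ξ = ρ g (toCoind ρ y ξ) := by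
  refine Ind_induction (p := fun ξ => toCoind ρ (g.val * y) ξ = ρ g (toCoind ρ y ξ))
    ?_ (fun ξ η hξ hη => ?_) (fun x v => ?_) ξ
  · simp only [map_zero]
  · simp only [map_add, hξ, hη]
  · by_cases h : ∃ g' : MaxSubgroup e, g'.val = y * x
    · obtain ⟨g', hg'⟩ := h
      rw [toCoind_of ρ hg', toCoind_of ρ (g := g * g') (by
        rw [MaxSubgroup.val_mul, hg', mul_assoc]), map_mul, Module.End.mul_apply]
    · rw [toCoind_of_not ρ h, toCoind_of_not ρ, map_zero]
      rintro ⟨g', hg'⟩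
      refine h ⟨g⁻¹ * g', ?_⟩
      rw [MaxSubgroup.val_mul, hg', ← mul_assoc, ← mul_assoc, g.inv_mul_val, hy]

lemma rho_mul_cancel {z x : M} (hz : z * x = e) (g g' : MaxSubgroup e)
    (h : x * g.val = x * g'.val) : g = g' := MaxSubgroup.val_injective <| by
  rw [← g.e_mul, ← g'.e_mul, ← hz, mul_assoc, h, mul_assoc]

/-- The coordinate at `a` of elements of the induced module, for a choice of representatives. -/
def indCoord (s : SandwichReps e) (a : RClasses (e : M)) : BalancedTensor (LRepG k e) ρ →ₗ[k] V :=
  relFunctional ρ (fun g x => x = s.rho a * g.val)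
    (fun g g' x h h' => by
      obtain ⟨-, z, hz⟩ := lRel_iff.1 (show LRel _ _ from (s.rho_mem a).1)
      exact rho_mul_cancel hz g g' (h.symm.trans h'))
    fun g x g' h => by rw [MaxSubgroup.val_mul, h, mul_assoc]

/-- `G_e` acts freely on `L_e`, and distinct `ρ_a` lie in distinct orbits since they lie in distinct
`𝓡`-classes. -/
lemma indCoord_rho (s : SandwichReps e) (a a' : RClasses (e : M)) (v : V) :
    indCoord ρ s a (indTmul ρ ⟨s.rho a', (s.rho_mem a').1⟩ v) = if a' = a then v else 0 := by
  rw [indCoord, relFunctional_indTmul]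
  split_ifs with h
  · subst h
    rw [relMap_of ρ (g := 1), map_one, Module.End.one_apply]
    · intro g g' x h h'
      obtain ⟨-, z, hz⟩ := lRel_iff.1 (show LRel _ _ from (s.rho_mem a').1)
      exact rho_mul_cancel hz g g' (h.symm.trans h')
    · rw [MaxSubgroup.val_one, LClass.mul_e (s.rho_mem a').1]
  · rw [relMap_of_not ρ, LinearMap.zero_apply]
    rintro ⟨g, hg⟩
    change s.rho a' = _ at hg
    refine h (Subtype.ext ?_)
    rw [← s.RClass_rho, ← s.RClass_rho]
    refine RClass_eq (rRel_iff.2 ⟨⟨g.val, hg.symm⟩, ⟨(g⁻¹).val, ?_⟩⟩)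
    rw [hg, mul_assoc, g.mul_inv_val, LClass.mul_e (s.rho_mem a).1]

/-! ### The kernel of `Ind → Coind` and the generating subspace `e ⊗ V`. -/

/-- The kernel of the map from the induced to the coinduced module. -/
def indKernel : Subrepresentation (Ind ρ) where
  toSubmodule := ⨅ y : RClass (e : M), LinearMap.ker (toCoind ρ (y : M))
  apply_mem_toSubmodule m ξ hξ := by
    simp only [Submodule.mem_iInf, LinearMap.mem_ker] at hξ ⊢
    intro y
    by_cases h : (y : M) * m ∈ RClass (e : M)
    · rw [(toCoind_Ind ρ y.2 ξ).1 h]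
      exact hξ ⟨_, h⟩
    · exact (toCoind_Ind ρ y.2 ξ).2 h

lemma mem_indKernel {ξ : BalancedTensor (LRepG k e) ρ} :
    ξ ∈ (indKernel ρ).toSubmodule ↔ ∀ y ∈ RClass (e : M), toCoind ρ y ξ = 0 := by
  change ξ ∈ (⨅ y : RClass (e : M), LinearMap.ker (toCoind ρ (y : M))) ↔ _
  simp [Submodule.mem_iInf]

/-- The element `e ⊗ v` of the induced module. -/
abbrev indIdem : V →ₗ[k] BalancedTensor (LRepG k e) ρ := indTmul ρ ⟨e, self_mem_LClass _⟩

lemma toCoind_indIdem (v : V) : toCoind ρ (e : M) (indIdem ρ v) = v := by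
  rw [toCoind_of ρ (g := 1) (by rw [MaxSubgroup.val_one]; exact e.2.symm), map_one,
    Module.End.one_apply]

lemma indIdem_injective : Function.Injective (indIdem ρ) := fun v w h => by
  rw [← toCoind_indIdem ρ v, h, toCoind_indIdem]

/-- If `ex ∈ L_e`, then `ex` is a unit of `eMe` and can be moved across the tensor sign. -/
lemma exists_Ind_idem_eq [Finite M] (ξ : BalancedTensor (LRepG k e) ρ) :
    ∃ v, Ind ρ (e : M) ξ = indIdem ρ v := by
  refine Ind_induction (p := fun ξ => ∃ v, Ind ρ (e : M) ξ = indIdem ρ v)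
    ⟨0, by rw [map_zero, map_zero]⟩ ?_ (fun x v => ?_) ξ
  · rintro ξ η ⟨v, hv⟩ ⟨w, hw⟩
    exact ⟨v + w, by rw [map_add, map_add, hv, hw]⟩
  · by_cases h : (e : M) * x ∈ LClass (e : M)
    · rw [Ind_indTmul ρ _ x v h]
      obtain ⟨g, hg⟩ := LClass.exists_unit h (by rw [← mul_assoc, e.2])
      refine ⟨ρ g v, ?_⟩
      rw [← indTmul_mul]
      congr 2
      refine Subtype.ext ?_
      change (e : M) * x = e * g.val
      rw [g.e_mul, hg]
    · exact ⟨0, by rw [Ind_indTmul_of_notMem ρ _ x v h, map_zero]⟩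

lemma Ind_indIdem (x : LClass (e : M)) (v : V) : Ind ρ (x : M) (indIdem ρ v) = indTmul ρ x v := by
  have hx : (x : M) * e = x := LClass.mul_e x.2
  rw [Ind_indTmul ρ _ _ v (by rw [hx]; exact x.2)]
  congr 2
  exact Subtype.ext hx

lemma Ind_unit_indIdem (g : MaxSubgroup e) (v : V) :
    Ind ρ g.val (indIdem ρ v) = indIdem ρ (ρ g v) := by
  have h := Ind_indIdem ρ ⟨g.val, g.mem_LClass⟩ v
  rw [← indTmul_mul]
  refine h.trans ?_
  congr 2
  exact Subtype.ext g.e_mul.symm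

-- The `w` with `e ⊗ w ∈ N` form a subrepresentation of `V`, so all of `V`; and `e ⊗ V` generates
-- the induced module.
variable {ρ} in
lemma eq_top_of_indIdem_mem (hρ : ρ.IsIrreducible) (N : Subrepresentation (Ind ρ)) {v : V}
    (hv : v ≠ 0) (hN : indIdem ρ v ∈ N.toSubmodule) : N.toSubmodule = ⊤ := by
  let T : Subrepresentation ρ :=
    { toSubmodule := N.toSubmodule.comap (indIdem ρ)
      apply_mem_toSubmodule := fun g w hw => by
        rw [Submodule.mem_comap, ← Ind_unit_indIdem]
        exact N.apply_mem_toSubmodule _ hw }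
  have hT : T = ⊤ := (hρ.eq_bot_or_eq_top T).resolve_left fun h => hv <| by
    have h1 : v ∈ T.toSubmodule := hN
    rw [h] at h1
    exact h1
  have hT' : ∀ w, indIdem ρ w ∈ N.toSubmodule := fun w => by
    have h1 : w ∈ T.toSubmodule := by rw [hT]; exact Submodule.mem_top (R := k)
    exact h1
  rw [eq_top_iff]
  rintro ξ -
  refine Ind_induction (p := (· ∈ N.toSubmodule)) N.toSubmodule.zero_mem
    (fun _ _ => N.toSubmodule.add_mem) (fun x w => ?_) ξ
  rw [← Ind_indIdem]
  exact N.apply_mem_toSubmodule _ (hT' w)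

end Ind

section Implications

variable {k : Type u} [Field k] {M : Type v} [Monoid M]

/-! ### Simplicity of induced modules implies left invertibility of the sandwich matrices -/

lemma ofModule'_asAlgebraHom {G V : Type*} [Monoid G] [AddCommGroup V] [Module k V]
    [Module (MonoidAlgebra k G) V] [IsScalarTower k (MonoidAlgebra k G) V]
    (a : MonoidAlgebra k G) (v : V) :
    (Representation.ofModule' (k := k) (G := G) V).asAlgebraHom a v = a • v := by
  induction a using MonoidAlgebra.induction_on with
  | of g => rw [Representation.asAlgebraHom_of]; rfl
  | add a b ha hb => rw [map_add, LinearMap.add_apply, ha, hb, add_smul]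
  | smul r a ha => rw [map_smul, LinearMap.smul_apply, ha, smul_assoc]

lemma ofModule'_isIrreducible {G V : Type*} [Monoid G] [AddCommGroup V] [Module k V]
    [Module (MonoidAlgebra k G) V] [IsScalarTower k (MonoidAlgebra k G) V]
    [IsSimpleModule (MonoidAlgebra k G) V] :
    (Representation.ofModule' (k := k) (G := G) V).IsIrreducible := by
  have := IsSimpleModule.nontrivial (MonoidAlgebra k G) V
  refine isIrreducible_of k _ fun N w hw hw0 => ?_
  rw [eq_top_iff]
  rintro z -
  refine (Submodule.span_le.2 ?_) (mem_span_act_of_isSimple (M := G) k hw0 z)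
  rintro _ ⟨g, rfl⟩
  exact N.apply_mem_toSubmodule g hw

lemma toCoind_rho {e : Idem M} {V : Type w} [AddCommGroup V] [Module k V]
    (ρ : Representation k (MaxSubgroup e) V) (s : SandwichReps e) (b : LClasses (e : M))
    (a : RClasses (e : M)) (v : V) :
    toCoind ρ (s.lam b) (indTmul ρ ⟨s.rho a, (s.rho_mem a).1⟩ v) =
      ρ.asAlgebraHom (sandwichMatrix k s b a) v := by
  by_cases hg : ∃ g : MaxSubgroup e, g.val = s.lam b * s.rho a
  · obtain ⟨g, hg⟩ := hg
    rw [toCoind_of ρ hg, sandwichMatrix_apply_of_eq s hg, Representation.asAlgebraHom_single,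
      one_smul]
  · rw [toCoind_of_not ρ hg, sandwichMatrix_apply_of_not s hg, map_zero, LinearMap.zero_apply]

variable [Finite M]

-- A left inverse exists exactly when the rows span the free left module: its rows are the
-- coefficients expressing the basis vectors.
open Classical in
lemma exists_isCoatom_of_not_isLeftInvertible {A B S : Type*} [Ring S] [Finite A] [Finite B]
    {P : Matrix B A S} (hP : ¬ IsLeftInvertible P) :
    ∃ N : Submodule S (A → S), IsCoatom N ∧ ∀ b, P b ∈ N := by
  let := Fintype.ofFinite B
  have hne : Submodule.span S (Set.range P) ≠ ⊤ := by
    intro h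
    apply hP
    have h1 : ∀ a, ∃ q : B → S, ∑ b, q b • P b = (Pi.single a 1 : A → S) := fun a =>
      (Submodule.mem_span_range_iff_exists_fun S).1 (h ▸ Submodule.mem_top)
    choose Q hQ using h1
    refine ⟨Matrix.of Q, ?_⟩
    ext a a'
    have h2 := congrFun (hQ a) a'
    rw [Finset.sum_apply, Pi.single_apply] at h2
    rw [Matrix.mul_apply, Matrix.one_apply]
    simp only [eq_comm (a := a)]
    rw [← h2]
    rfl
  obtain ⟨N, hN, hle⟩ := (eq_top_or_exists_le_coatom _).resolve_left hne
  exact ⟨N, hN, fun b => hle (Submodule.subset_span ⟨b, rfl⟩)⟩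

-- With `V` the simple quotient by a maximal `N` containing the rows and `v_a` the image of the
-- `a`-th basis vector, applying `λ_b` to `Σ ρ_a ⊗ v_a` gives the class of row `b`, which is zero.
open Classical in
theorem isLeftInvertible_of_isIrreducible_Ind {e : Idem M} (s : SandwichReps e)
    (h : ∀ (V : Type (max u v)) [AddCommGroup V] [Module k V]
      (ρ : Representation k (MaxSubgroup e) V), ρ.IsIrreducible → (Ind ρ).IsIrreducible) :
    IsLeftInvertible (sandwichMatrix k s) := by
  by_contra hP
  obtain ⟨N, hN, hPN⟩ := exists_isCoatom_of_not_isLeftInvertible hP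
  let := Fintype.ofFinite (RClasses (e : M))
  let V := (RClasses (e : M) → MonoidAlgebra k (MaxSubgroup e)) ⧸ N
  have hV : IsSimpleModule (MonoidAlgebra k (MaxSubgroup e)) V := isSimpleModule_iff_isCoatom.2 hN
  let ρ : Representation k (MaxSubgroup e) V := Representation.ofModule' V
  have hρ : ρ.IsIrreducible := ofModule'_isIrreducible
  let v : RClasses (e : M) → V := fun a => N.mkQ (Pi.single a 1)
  let ξ : BalancedTensor (LRepG k e) ρ :=
    ∑ a, indTmul ρ ⟨s.rho a, (s.rho_mem a).1⟩ (v a)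
  -- The `v a` generate the nonzero module `V`.
  have hv : ∃ a, v a ≠ 0 := by
    by_contra! hv
    refine hN.1 (Submodule.eq_top_iff'.2 fun x => ?_)
    rw [pi_eq_sum_univ' x]
    refine N.sum_mem fun a _ => N.smul_mem _ ?_
    have := (Submodule.Quotient.mk_eq_zero N).1 (hv a)
    convert this using 1
  obtain ⟨a₀, ha₀⟩ := hv
  have hξ0 : ξ ≠ 0 := by
    intro h0
    have h1 : indCoord ρ s a₀ ξ = v a₀ := by
      rw [map_sum, Finset.sum_eq_single a₀]
      · rw [indCoord_rho, if_pos rfl]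
      · intro a _ ha
        rw [indCoord_rho, if_neg ha]
      · simp
    rw [h0, map_zero] at h1
    exact ha₀ h1.symm
  have hξ : ξ ∈ (indKernel ρ).toSubmodule := by
    rw [mem_indKernel]
    intro y hy
    obtain ⟨g, b, rfl⟩ := s.exists_eq_mul_lam hy
    have h1 : toCoind ρ (s.lam b) ξ = N.mkQ (sandwichMatrix k s b) := by
      rw [map_sum, pi_eq_sum_univ' (sandwichMatrix k s b), map_sum]
      refine Finset.sum_congr rfl fun a _ => ?_
      rw [toCoind_rho, ofModule'_asAlgebraHom, map_smul]
    have h2 : N.mkQ (sandwichMatrix k s b) = 0 := (Submodule.Quotient.mk_eq_zero N).2 (hPN b)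
    rw [toCoind_mul ρ g ((isBiset_RClass e).e_mul (s.lam_mem b).1), h1, h2, map_zero]
  -- The kernel contains `ξ ≠ 0` but not `e ⊗ v_{a₀}`, whose component at `e` is `v_{a₀}`.
  rcases (h V ρ hρ).eq_bot_or_eq_top (indKernel ρ) with hK | hK
  · rw [hK] at hξ
    exact hξ0 hξ
  · have h1 : indIdem ρ (v a₀) ∈ (indKernel ρ).toSubmodule := by
      rw [hK]; exact Submodule.mem_top (R := k)
    have h2 := (mem_indKernel ρ).1 h1 e (self_mem_RClass _)
    rw [toCoind_indIdem] at h2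
    exact ha₀ h2

/-! ### Injectivity of the modules `Hom_G(R̃_e, V)` implies simplicity of induced modules -/

variable [IsLeftFountain M]

/-- The map `s ↦ (x ↦ xs)` from a module `S` to `Hom_G(R̃_e, eS)`. -/
def toHomCorner {S : Type*} [AddCommGroup S] [Module k S] [Module (MonoidAlgebra k M) S]
    [IsScalarTower k (MonoidAlgebra k M) S] {e : Idem M} (h : IsApex k S e) :
    S →ₗ[MonoidAlgebra k M] (HomRTilde (cornerRep k S e)).asModule :=
  homOfLinear (cornerRep k S e) (act k (e : M)).rangeRestrict
    (fun g y => Subtype.ext (by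
      change act k (e : M) (act k g.val y) = act k g.val (act k (e : M) y)
      rw [← act_mul, ← act_mul, g.e_mul, g.mul_e]))
    (fun y hy => by
      refine Submodule.span_induction ?_ (map_zero _) ?_ ?_ hy
      · rintro _ ⟨m, y, h1, h2, rfl⟩
        refine Subtype.ext ?_
        change act k (e : M) (act k m y) = 0
        rw [← act_mul]
        -- By the apex property an `m ∈ eM` acting nontrivially would lie in `R_e ⊆ R̃_e`.
        by_contra h3
        have h4 := h.mul_mem_RClass k h3
        rw [h1] at h4
        exact h2 (RClass.mem_RTildeClass h4)
      · intro x y _ _ hx hy; rw [map_add, hx, hy, add_zero]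
      · intro c x _ hx; rw [map_smul, hx, smul_zero])

lemma toHomCorner_ne_zero {S : Type*} [AddCommGroup S] [Module k S] [Module (MonoidAlgebra k M) S]
    [IsScalarTower k (MonoidAlgebra k M) S] {e : Idem M} (h : IsApex k S e) {s : S}
    (hs : act k (e : M) s ≠ 0) : toHomCorner h s ≠ 0 := by
  intro h0
  have h1 : ((act k (e : M)).rangeRestrict (act k (e : M) s) : S) = 0 :=
    congrArg Subtype.val (congrArg (evalIdem (cornerRep k S e)) h0)
  apply hs
  change act k (e : M) (act k (e : M) s) = 0 at h1
  rwa [← act_mul, e.2] at h1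

/-- There are no non-zero maps from an induced module to `Hom_G(R̃_f, W)` if `f` is not
`𝓙`-equivalent to `e`. -/
lemma eq_zero_of_not_jRel {e f : Idem M} (hef : ¬ JRel (e : M) f) {V W : Type w}
    [AddCommGroup V] [Module k V] [AddCommGroup W] [Module k W]
    (ρ : Representation k (MaxSubgroup e) V) (σ : Representation k (MaxSubgroup f) W)
    (φ : (Ind ρ).asModule →ₗ[MonoidAlgebra k M] (HomRTilde σ).asModule) : φ = 0 := by
  have hφ0 : ∀ v, φ ((Ind ρ).asModuleEquiv.symm (indIdem ρ v)) = 0 := by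
    intro v
    by_contra hne
    have hval : ∃ x, ((HomRTilde σ).asModuleEquiv
        (φ ((Ind ρ).asModuleEquiv.symm (indIdem ρ v)))).1 x ≠ 0 := by
      by_contra! h0
      exact hne (HomG.ext (hX := isBiset_RTildeClass f) (ρ := σ) h0)
    obtain ⟨x, hx⟩ := hval
    -- The image of `e ⊗ v` is fixed by `e` and killed by each `me ∉ L_e`, so a nonzero value at `x`
    -- puts `xe` in `R_f ∩ L_e`.
    obtain ⟨h1, h2⟩ := mem_of_apply_ne_zero σ (f := e) _
      (by
        rw [← map_act, act_asModule]
        congr 2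
        exact Ind_indIdem ρ ⟨e, self_mem_LClass _⟩ v)
      (fun m hm => by
        by_contra hL
        apply hm
        rw [← map_act, act_asModule]
        have : Ind ρ (m * e) (indIdem ρ v) = 0 :=
          Ind_indTmul_of_notMem ρ _ _ v (by rwa [mul_assoc, e.2])
        change φ ((Ind ρ).asModuleEquiv.symm (Ind ρ (m * e) (indIdem ρ v))) = 0
        rw [this, map_zero, map_zero]) hx
    exact hef (jRel_of_mem h1 h2)
  have hφ1 : ∀ η, φ ((Ind ρ).asModuleEquiv.symm η) = 0 := by
    refine Ind_induction (p := fun η => φ ((Ind ρ).asModuleEquiv.symm η) = 0)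
      (by rw [map_zero, map_zero]) (fun ξ η hξ hη => ?_) fun x v => ?_
    · rw [map_add, map_add, hξ, hη, add_zero]
    · rw [← Ind_indIdem, Representation.asModuleEquiv_symm_map_rho, map_smul, hφ0, smul_zero]
  exact LinearMap.ext hφ1

/-- Each non-zero submodule of a `kM`-module is detected by a map to some `Hom_G(R̃_e, W)`, if the
latter modules are injective. -/
lemma exists_hom_ne_zero {n : ℕ} (e : Fin n → Idem M)
    (he : ∀ f : Idem M, ∃! i, JRel (f : M) (e i : M))
    (h : ∀ (i : Fin n) (V : Type (max u v)) [AddCommGroup V] [Module k V]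
      (ρ : Representation k (MaxSubgroup (e i)) V), ρ.IsIrreducible →
        Module.Injective (MonoidAlgebra k M) (HomRTilde ρ).asModule)
    {X : Type (max u v)} [AddCommGroup X] [Module k X] [Module (MonoidAlgebra k M) X]
    [IsScalarTower k (MonoidAlgebra k M) X] {T : Submodule (MonoidAlgebra k M) X} (hT : T ≠ ⊥) :
    ∃ (j : Fin n) (W : Type (max u v)) (_ : AddCommGroup W) (_ : Module k W)
      (σ : Representation k (MaxSubgroup (e j)) W)
      (φ : X →ₗ[MonoidAlgebra k M] (HomRTilde σ).asModule), ∃ t ∈ T,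
        act k (e j : M) t ≠ 0 ∧ φ t ≠ 0 := by
  obtain ⟨S, hST, hS⟩ := exists_isSimpleModule_le hT
  obtain ⟨j, hj⟩ := exists_isApex k (Y := S) e he
  obtain ⟨s, hs⟩ := hj.exists_ne
  have hI := h j (corner k S (e j : M)) (cornerRep k S (e j)) (hj.cornerRep_isIrreducible k)
  -- Injectivity extends `toHomCorner` from the simple submodule `S` to all of `X`.
  obtain ⟨φ, hφ⟩ := hI.out S.subtype S.injective_subtype (toHomCorner hj)
  refine ⟨j, corner k S (e j : M), inferInstance, inferInstance, cornerRep k S (e j), φ, s, hST s.2, fun h0 => hs (Subtype.ext ?_), ?_⟩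
  · rw [coe_act, h0]; rfl
  · rw [show φ s = toHomCorner hj s from hφ s]
    exact toHomCorner_ne_zero hj hs

/-- A submodule on which `e_i` acts nontrivially contains some `e_i ⊗ v ≠ 0`. One killed by `e_i` is
detected by a nonzero map from `Ind V` to some `Hom_G(R̃_{e_j}, W)` with `j ≠ i`, contradicting
`eq_zero_of_not_jRel`. -/
theorem isIrreducible_Ind_of_injective {n : ℕ} (e : Fin n → Idem M)
    (he : ∀ f : Idem M, ∃! i, JRel (f : M) (e i : M))
    (h : ∀ (i : Fin n) (V : Type (max u v)) [AddCommGroup V] [Module k V]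
      (ρ : Representation k (MaxSubgroup (e i)) V), ρ.IsIrreducible →
        Module.Injective (MonoidAlgebra k M) (HomRTilde ρ).asModule)
    (i : Fin n) {V : Type (max u v)} [AddCommGroup V] [Module k V]
    (ρ : Representation k (MaxSubgroup (e i)) V) (hρ : ρ.IsIrreducible) :
    (Ind ρ).IsIrreducible := by
  have hnt : Nontrivial V := by
    by_contra hV
    rw [not_nontrivial_iff_subsingleton] at hV
    exact bot_ne_top (α := Subrepresentation ρ)
      (Subrepresentation.toSubmodule_injective (Subsingleton.elim _ _))
  have : Nontrivial (BalancedTensor (LRepG k (e i)) ρ) := (indIdem_injective ρ).nontrivial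
  refine isIrreducible_of k _ fun N ξ hξ hξ0 => ?_
  by_cases hN : ∃ η ∈ N.toSubmodule, Ind ρ (e i : M) η ≠ 0
  · obtain ⟨η, hη, hη0⟩ := hN
    obtain ⟨v, hv⟩ := exists_Ind_idem_eq ρ η
    refine eq_top_of_indIdem_mem hρ N (v := v) (fun h0 => hη0 ?_) ?_
    · rw [hv, h0, map_zero]
    · rw [← hv]; exact N.apply_mem_toSubmodule _ hη
  push Not at hN
  exfalso
  have hN' : N.asSubmodule ≠ ⊥ := (Submodule.ne_bot_iff _).2 ⟨ξ, hξ, hξ0⟩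
  obtain ⟨j, W, _, _, σ, φ, t, ht, ht0, hφ⟩ := exists_hom_ne_zero e he h hN'
  have hij : i ≠ j := by
    rintro rfl
    refine ht0 ?_
    rw [act_asModule]
    exact hN t ht
  have hφ0 : φ = 0 := by
    refine eq_zero_of_not_jRel (fun h => hij ?_) ρ σ φ
    obtain ⟨l, -, hl⟩ := he (e i)
    exact (hl i rfl).trans (hl j h).symm
  rw [hφ0, LinearMap.zero_apply] at hφ
  exact hφ rfl

end Implications

/-! ### The dual of `D(V) ⊗ kR̃_e` -/

section Dual

lemma finite_of_isIrreducible {k G V : Type*} [Field k] [Monoid G] [Finite G] [AddCommGroup V]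
    [Module k V] {ρ : Representation k G V} (h : ρ.IsIrreducible) : Module.Finite k V := by
  rcases subsingleton_or_nontrivial V with hV | hV
  · infer_instance
  obtain ⟨v, hv⟩ := exists_ne (0 : V)
  let N : Subrepresentation ρ :=
    { toSubmodule := Submodule.span k (Set.range fun g => ρ g v)
      apply_mem_toSubmodule := fun g x hx => by
        induction hx using Submodule.span_induction with
        | mem x hx =>
          obtain ⟨g', rfl⟩ := hx
          exact Submodule.subset_span ⟨g * g', by simp only [map_mul, Module.End.mul_apply]⟩
        | zero => rw [map_zero]; exact zero_mem _
        | add x y _ _ hx hy => rw [map_add]; exact add_mem hx hy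
        | smul c x _ hx => rw [map_smul]; exact Submodule.smul_mem _ c hx }
  have hvN : v ∈ N.toSubmodule :=
    Submodule.subset_span ⟨1, by simp only [map_one, Module.End.one_apply]⟩
  rcases h.eq_bot_or_eq_top N with hN | hN
  · rw [hN] at hvN
    exact absurd hvN hv
  · have h1 : Submodule.span k (Set.range fun g => ρ g v) = ⊤ :=
      congrArg Subrepresentation.toSubmodule hN
    exact Module.finite_def.2 (h1 ▸ Submodule.fg_span (Set.finite_range _))

variable {k : Type u} [Field k] {M : Type v} [Monoid M] {e : Idem M} {X : Set M}
  (hX : IsBiset e X) {V : Type w} [AddCommGroup V] [Module k V]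
  (ρ : Representation k (MaxSubgroup e) V)

lemma linearCombination_bisetRepG (F : HomG hX ρ) (g : MaxSubgroup e) (y : X →₀ k) :
    Finsupp.linearCombination k F.1 (bisetRepG k hX g y) =
      ρ g (Finsupp.linearCombination k F.1 y) := by
  induction y using Finsupp.induction_linear with
  | zero => simp only [map_zero]
  | add x y hx hy => simp only [map_add, hx, hy]
  | single x c =>
    rw [show bisetRepG k hX g (Finsupp.single x c) = Finsupp.single ⟨g.val * x, hX.G_mul g x.2⟩ c
      from partialMap_single (f := fun x => g.val * x) (hX.G_mul g x.2) c,
      Finsupp.linearCombination_single, Finsupp.linearCombination_single, map_smul, F.2 g x]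

/-- The functional on `D(V) ⊗ kX` given by an equivariant map `F : X → V`. -/
def homFunctional (F : HomG hX ρ) :
    Module.Dual k (BalancedTensor (rightDual ρ) (bisetRepG k hX)) :=
  balancedLift _ _ (LinearMap.lcomp k k (Finsupp.linearCombination k F.1)) fun θ g y =>
    congrArg θ (linearCombination_bisetRepG hX ρ F g y).symm

lemma homFunctional_mk (F : HomG hX ρ) (θ : Module.Dual k V) (x : X) (c : k) :
    homFunctional hX ρ F (balancedMk _ _ θ (Finsupp.single x c)) = c * θ (F.1 x) := by
  change θ (Finsupp.linearCombination k F.1 (Finsupp.single x c)) = _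
  rw [Finsupp.linearCombination_single, map_smul, smul_eq_mul]

variable {hX ρ} in
lemma dual_ext {F F' : Module.Dual k (BalancedTensor (rightDual ρ) (bisetRepG k hX))}
    (h : ∀ θ x, F (balancedMk _ _ θ (Finsupp.single x 1)) =
      F' (balancedMk _ _ θ (Finsupp.single x 1))) : F = F' := by
  refine LinearMap.ext <| balanced_induction (by rw [map_zero, map_zero])
    (fun ξ η hξ hη => by rw [map_add, map_add, hξ, hη]) fun θ y => ?_
  have h1 : F ∘ₗ balancedMk _ _ θ = F' ∘ₗ balancedMk _ _ θ :=
    Finsupp.lhom_ext' fun x => LinearMap.ext_ring (h θ x)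
  exact LinearMap.congr_fun h1 y

/-- The linear map from `Hom_G(X, V)` to the dual of `D(V) ⊗ kX`. -/
def homToDual : HomG hX ρ →ₗ[k] Module.Dual k (BalancedTensor (rightDual ρ) (bisetRepG k hX)) where
  toFun := homFunctional hX ρ
  map_add' F F' := dual_ext fun θ x => by
    rw [LinearMap.add_apply, homFunctional_mk, homFunctional_mk, homFunctional_mk, HomG.add_val,
      map_add, mul_add]
  map_smul' c F := dual_ext fun θ x => by
    rw [LinearMap.smul_apply, homFunctional_mk, homFunctional_mk, HomG.smul_val, map_smul,
      RingHom.id_apply, smul_eq_mul, smul_eq_mul, one_mul, one_mul]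

/-- A functional `Φ` assigns to `x` the functional `θ ↦ Φ(θ ⊗ x)` on `D(V)`, which is evaluation at
a unique vector of the finite-dimensional `V`; balancedness of the tensor product becomes
equivariance in `x`. -/
lemma homToDual_bijective [Module.Finite k V] : Function.Bijective (homToDual hX ρ) := by
  constructor
  · intro F F' h
    refine HomG.ext fun x => ?_
    refine (Module.evalEquiv k V).injective (LinearMap.ext fun θ => ?_)
    have h1 := LinearMap.congr_fun h (balancedMk _ _ θ (Finsupp.single x 1))
    change homFunctional hX ρ F _ = homFunctional hX ρ F' _ at h1
    rwa [homFunctional_mk, homFunctional_mk, one_mul, one_mul] at h1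
  · intro Φ
    let c : X → Module.Dual k (Module.Dual k V) := fun x =>
      Φ ∘ₗ (balancedMk (rightDual ρ) (bisetRepG k hX)).flip (Finsupp.single x 1)
    have hc : ∀ x θ, θ ((Module.evalEquiv k V).symm (c x)) = c x θ := fun x θ =>
      Module.apply_evalEquiv_symm_apply k V θ (c x)
    let F : HomG hX ρ := HomG.mk (fun x => (Module.evalEquiv k V).symm (c x)) fun g x => by
      refine (Module.evalEquiv k V).injective (LinearMap.ext fun θ => ?_)
      change θ ((Module.evalEquiv k V).symm _) =
        (rightDual ρ (MulOpposite.op g) θ) ((Module.evalEquiv k V).symm _)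
      rw [hc, hc]
      change Φ (balancedMk _ _ _ _) = Φ (balancedMk _ _ _ _)
      rw [balancedMk_act, show bisetRepG k hX g (Finsupp.single x 1) =
        Finsupp.single ⟨g.val * x, hX.G_mul g x.2⟩ 1
        from partialMap_single (f := fun x => g.val * x) (hX.G_mul g x.2) 1]
    refine ⟨F, dual_ext fun θ x => ?_⟩
    change homFunctional hX ρ F _ = _
    rw [homFunctional_mk, one_mul]
    exact hc x θ

lemma homToDual_homRep (m : M) (F : HomG hX ρ) :
    homToDual hX ρ (homRep hX ρ m F) =
      leftDual (tensorActRight (rightDual ρ) (bisetRepG k hX) (bisetRep k hX)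
        (bisetRep_comm k hX)) m (homToDual hX ρ F) := by
  refine dual_ext fun θ x => ?_
  change homFunctional hX ρ (homAct m F) (balancedMk _ _ θ (Finsupp.single x 1)) =
    homFunctional hX ρ F (tensorActRight (rightDual ρ) (bisetRepG k hX) (bisetRep k hX)
      (bisetRep_comm k hX) (MulOpposite.op m) (balancedMk _ _ θ (Finsupp.single x 1)))
  rw [tensorActRight_mk, homFunctional_mk, one_mul]
  by_cases h : (x : M) * m ∈ X
  · rw [homAct_of_mem F h, show bisetRep k hX (MulOpposite.op m) (Finsupp.single x 1) =
      Finsupp.single ⟨x * m, h⟩ 1 from partialMap_single (f := fun x => x * m) h 1,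
      homFunctional_mk, one_mul]
  · rw [homAct_of_notMem F h, show bisetRep k hX (MulOpposite.op m) (Finsupp.single x 1) = 0
      from partialMap_single_of_notMem (f := fun x => x * m) h 1, map_zero, map_zero, map_zero]

theorem nonempty_leftDual_equiv_homRTilde [Finite M] [IsLeftFountain M] (hρ : ρ.IsIrreducible) :
    Nonempty ((leftDual (dualTensorRTilde ρ)).Equiv (HomRTilde ρ)) := by
  have := finite_of_isIrreducible hρ
  let E := LinearEquiv.ofBijective _ (homToDual_bijective (isBiset_RTildeClass e) ρ)
  have h : ∀ m, E.toLinearMap ∘ₗ HomRTilde ρ m = leftDual (dualTensorRTilde ρ) m ∘ₗ E.toLinearMap :=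
    fun m => by
      refine LinearMap.ext fun F => ?_
      exact homToDual_homRep (isBiset_RTildeClass e) ρ m F
  exact ⟨(Representation.Equiv.mk E h).symm⟩

end Dual

end FountainMonoid

end

/-! ### The equivalences and the duality isomorphism. -/

theorem theoremt {k : Type u} [Field k] {M : Type v} [Monoid M] [Finite M]
    [IsLeftFountain M]
    (hchar : ∀ e : Idem M, ¬ ringChar k ∣ Nat.card (MaxSubgroup e))
    {n : ℕ} (e : Fin n → Idem M)
    (he : ∀ f : Idem M, ∃! i, JRel (f : M) (e i : M)) :
    [ ∀ (i : Fin n) (s : SandwichReps (e i)), IsLeftInvertible (sandwichMatrix k s),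
      ∀ (i : Fin n) (V : Type (max u v)) [AddCommGroup V] [Module k V]
        (ρ : Representation k (MaxSubgroup (e i)) V),
        ρ.IsIrreducible → (Ind ρ).IsIrreducible,
      ∀ (i : Fin n) (V : Type (max u v)) [AddCommGroup V] [Module k V]
        (ρ : Representation k (MaxSubgroup (e i)) V),
        ρ.IsIrreducible →
          IsInjectiveEnvelope (MonoidAlgebra k M) (Sharp ρ).asModule (HomRTilde ρ).asModule ].TFAE ∧
    ∀ (i : Fin n) (V : Type (max u v)) [AddCommGroup V] [Module k V]
      (ρ : Representation k (MaxSubgroup (e i)) V),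
      ρ.IsIrreducible →
        Nonempty ((leftDual (dualTensorRTilde ρ)).Equiv (HomRTilde ρ)) := by
  constructor
  · tfae_have 1 → 3 := by
      intro hP i V _ _ ρ hρ
      obtain ⟨R⟩ := exists_rTildeReps (M := M)
      let := Fintype.ofFinite (Set.range (RTildeClass : M → Set M))
      exact ⟨injective_HomRTilde ρ (hchar (e i)) (simpleBound_of_isLeftInvertible e he hP R),
        sharpInclusion ρ, sharpInclusion_injective ρ, sharpInclusion_essential e he i ρ⟩
    -- Only the injectivity part of the envelope condition is needed here.
    tfae_have 3 → 2 := fun h i V _ _ ρ hρ =>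
      isIrreducible_Ind_of_injective e he (fun i V _ _ ρ hρ => (h i V ρ hρ).1) i ρ hρ
    tfae_have 2 → 1 := fun h i s => isLeftInvertible_of_isIrreducible_Ind s (h i)
    tfae_finish
  · exact fun i V _ _ ρ hρ => nonempty_leftDual_equiv_homRTilde ρ hρ
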